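/- Let $r \ge 2$ and $s \ge r+1$ be integers, let $Y$ be the blowup of $\mathbb{P}^r$ at $s$ general points, and let $A^{r-1}(Y)$ be its group of curve classes, free abelian with basis $h$ (the class of a general line) and $e_1,\dots,e_s$ (the classes of lines in the exceptional divisors). Write a class as $c = dh-\sum_i m_i e_i$; here $d$ is the degree of $c$ and the $m_i$ are its multiplicities. For a set $I\subset\{1,\dots,s\}$ with $|I|=r+1$, the standard Cremona transformation $\phi_I$ acts by $d' = d+(r-1)t$, $m_i' = m_i+t$ for $i\in I$ and $m_i'=m_i$ for $i\notin I$, where $t=d-\sum_{i\in I}m_i$; write $\phi=\phi_{\{1,\dots,r+1\}}$. The Weyl group is generated by all $\phi_I$ and by the permutations of $e_1,\dots,e_s$. A $(-1)$-Weyl line class is an element of the Weyl group orbit of $h-e_1-e_2$. A class is Cremona reduced if $d\ge\sum_{i\in I}m_i$ for every $I$ with $|I|=r+1$. Let $c$ be a $(-1)$-Weyl line class with $d\ge 0$ and all $m_i\ge 0$. Then $c$ is not Cremona reduced. If moreover $d>r$, then $s\ge r+3$, and the algorithm that repeats the step "reorder the multiplicities in non-increasing order, then apply $\phi$ (to the $r+1$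 largest multiplicities)" reaches from $c$, after finitely many steps and up to reordering the multiplicities, the class $rh-\sum_{i=1}^{r+3}e_i$ of the rational normal curve of degree $r$ through $r+3$ of the points. Each step up to that point strictly lowers the degree, and all the classes that occur up to that point have non-negative degree and multiplicities. Finally, whenever $s\ge r+3$, one further application of $\phi$ to $rh-\sum_{i=1}^{r+3}e_i$ gives $h-e_1-e_2$ up to reordering the multiplicities. -/

import Mathlib

namespace CremonaCurve

/-- The group `A^{r-1}(Y)` of curve classes of the blowup `Y` of `ℙ^r` at `s` general points:
it is free with basis `h, e_1, …, e_s`. The pair `(d, m)` stands for the class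
`d h - ∑ i, m i e_i` (see `eq_sum`), so `d` is the degree and the `m i` are the multiplicities. -/
abbrev CurveClass (s : ℕ) : Type := ℤ × (Fin s → ℤ)

namespace CurveClass

variable {s : ℕ}

/-- The degree `d` of `d h - ∑ i, m i e_i`. -/
def deg (c : CurveClass s) : ℤ := c.1

/-- The multiplicity `m i` of `d h - ∑ i, m i e_i`. -/
def mult (c : CurveClass s) (i : Fin s) : ℤ := c.2 i

/-- The class of a general line. -/
def h : CurveClass s := (1, 0)

/-- The class of a line in the `i`-th exceptional divisor. -/
def e (i : Fin s) : CurveClass s := (0, -Pi.single i 1)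

theorem eq_sum (c : CurveClass s) : c = c.deg • h - ∑ i, c.mult i • e i := by
  refine Prod.ext ?_ ?_
  · simp [deg, h, e, Prod.fst_sum]
  · funext j
    simp [mult, h, e, Prod.snd_sum, Finset.sum_apply, Pi.single_apply]

/-- Degree and all multiplicities are non-negative. -/
def Nonneg (c : CurveClass s) : Prop := 0 ≤ c.deg ∧ ∀ i, 0 ≤ c.mult i

end CurveClass

open CurveClass

/-- The quantity `t = d - ∑ i ∈ I, m i`. -/
def excess {s : ℕ} (I : Finset (Fin s)) (c : CurveClass s) : ℤ :=
  c.deg - ∑ i ∈ I, c.mult i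

/-- The action of the standard Cremona transformation of `ℙ^r` based at the points of `I`:
`d' = d + (r - 1) t`, `m' i = m i + t` for `i ∈ I`, and `m' i = m i` for `i ∉ I`.
It is used for `I` with `r + 1` elements. -/
def cremona (r : ℕ) {s : ℕ} (I : Finset (Fin s)) (c : CurveClass s) : CurveClass s :=
  (c.deg + ((r : ℤ) - 1) * excess I c,
    fun i => if i ∈ I then c.mult i + excess I c else c.mult i)

theorem excess_cremona (r : ℕ) {s : ℕ} (I : Finset (Fin s)) (hI : I.card = r + 1)
    (c : CurveClass s) : excess I (cremona r I c) = -excess I c := by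
  have h1 : ∑ i ∈ I, (cremona r I c).mult i = ∑ i ∈ I, (c.mult i + excess I c) :=
    Finset.sum_congr rfl fun i hi => by simp [cremona, mult, hi]
  have h2 : (cremona r I c).deg = c.deg + ((r : ℤ) - 1) * excess I c := rfl
  have h3 : excess I (cremona r I c)
      = (cremona r I c).deg - ∑ i ∈ I, (cremona r I c).mult i := rfl
  have h4 : ∑ i ∈ I, c.mult i = c.deg - excess I c := by simp [excess]
  rw [h3, h1, h2, Finset.sum_add_distrib, h4, Finset.sum_const, hI]
  push_cast [nsmul_eq_mul]
  ring

theorem cremona_cremona (r : ℕ) {s : ℕ} (I : Finset (Fin s)) (hI : I.card = r + 1)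
    (c : CurveClass s) : cremona r I (cremona r I c) = c := by
  have ht := excess_cremona r I hI c
  refine Prod.ext ?_ ?_
  · change (cremona r I c).deg + ((r : ℤ) - 1) * excess I (cremona r I c) = c.1
    rw [ht]
    simp [cremona, deg]
  · funext i
    change (if i ∈ I then (cremona r I c).mult i + excess I (cremona r I c)
      else (cremona r I c).mult i) = c.2 i
    rw [ht]
    by_cases hi : i ∈ I <;> simp [cremona, mult, hi]

/-- The standard Cremona transformation `φ_I`, `|I| = r + 1`, as an automorphism of the group
of curve classes. -/
def cremonaEquiv (r : ℕ) {s : ℕ} (I : Finset (Fin s)) (hI : I.card = r + 1) :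
    CurveClass s ≃ₗ[ℤ] CurveClass s where
  toFun := cremona r I
  invFun := cremona r I
  left_inv := cremona_cremona r I hI
  right_inv := cremona_cremona r I hI
  map_add' a b := by
    refine Prod.ext ?_ (funext fun i => ?_)
    · simp [cremona, excess, deg, mult, Finset.sum_add_distrib]
      ring
    · by_cases hi : i ∈ I <;>
        simp [cremona, excess, deg, mult, Finset.sum_add_distrib, hi]
      ring
  map_smul' k a := by
    refine Prod.ext ?_ (funext fun i => ?_)
    · simp [cremona, excess, deg, mult, ← Finset.mul_sum]
      ring
    · by_cases hi : i ∈ I <;>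
        simp [cremona, excess, deg, mult, ← Finset.mul_sum, hi]
      ring

/-- The action of a permutation of the points: `h ↦ h` and `e_i ↦ e_{σ i}`. -/
def permEquiv {s : ℕ} (σ : Equiv.Perm (Fin s)) : CurveClass s ≃ₗ[ℤ] CurveClass s :=
  (LinearEquiv.refl ℤ ℤ).prodCongr (LinearEquiv.funCongrLeft ℤ ℤ σ.symm)

theorem permEquiv_e {s : ℕ} (σ : Equiv.Perm (Fin s)) (i : Fin s) :
    permEquiv σ (e i) = e (σ i) := by
  refine Prod.ext ?_ (funext fun j => ?_)
  · simp [permEquiv, e]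
  · simp [permEquiv, e, Pi.single_apply, LinearMap.funLeft, Equiv.symm_apply_eq]

/-- The Weyl group acting on curve classes: it is generated by the standard Cremona
transformations `φ_I`, `|I| = r + 1`, and the permutations of the points. -/
def weylGroup (r s : ℕ) : Subgroup (CurveClass s ≃ₗ[ℤ] CurveClass s) :=
  Subgroup.closure
    ({g | ∃ (I : Finset (Fin s)) (hI : I.card = r + 1), g = cremonaEquiv r I hI} ∪
      Set.range permEquiv)

/-- The class `h - e_1 - e_2` of the line through the first two points. -/
def lineClass (s : ℕ) (hs : 2 ≤ s) : CurveClass s :=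
  h - e ⟨0, by omega⟩ - e ⟨1, by omega⟩

/-- A class of a `(-1)`-Weyl line: an element of the Weyl group orbit of `h - e_1 - e_2`. -/
def IsWeylLineClass (r s : ℕ) (hs : 2 ≤ s) (c : CurveClass s) : Prop :=
  c ∈ MulAction.orbit (weylGroup r s) (lineClass s hs)

/-- `d ≥ ∑ i ∈ I, m i` for every set `I` of `r + 1` indices. -/
def IsCremonaReduced (r : ℕ) {s : ℕ} (c : CurveClass s) : Prop :=
  ∀ I : Finset (Fin s), I.card = r + 1 → ∑ i ∈ I, c.mult i ≤ c.deg

/-- The first `k` indices. -/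
def firstIndices (s k : ℕ) : Finset (Fin s) := Finset.univ.filter fun i => i.val < k

/-- `φ = φ_I` for `I` the set of the first `r + 1` indices. -/
def phi (r : ℕ) {s : ℕ} (c : CurveClass s) : CurveClass s :=
  cremona r (firstIndices s (r + 1)) c

/-- Reorder the multiplicities in non-increasing order. -/
def sortMult {s : ℕ} (c : CurveClass s) : CurveClass s :=
  (c.deg, c.mult ∘ Tuple.sort fun i => -c.mult i)

theorem sortMult_antitone {s : ℕ} (c : CurveClass s) : Antitone (sortMult c).mult := by
  intro i j hij
  have := Tuple.monotone_sort (fun i => -c.mult i) hij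
  simpa [sortMult, mult] using this

/-- One round of the reduction algorithm: sort the multiplicities in non-increasing order, then
apply `φ` to the first, hence largest, `r + 1` of them. -/
def reductionStep (r : ℕ) {s : ℕ} (c : CurveClass s) : CurveClass s :=
  phi r (sortMult c)

/-- The class `r h - e_1 - ⋯ - e_{r+3}` of the rational normal curve through the first `r + 3`
points (meaningful when `r + 3 ≤ s`). -/
def rationalNormalClass (r s : ℕ) : CurveClass s :=
  (r : ℤ) • h - ∑ i ∈ firstIndices s (r + 3), e i

end CremonaCurve

/-!
The Weyl group `W` is a simply laced reflection group: in the coordinates `(d, m)` its simple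
reflections are `φ` and the transpositions of adjacent points, and it preserves the form
`d d' - (r - 1) ∑ m_i m'_i` and the class `(r + 1) h - ∑ e_i`. Under the form, the exceptional
divisor `E_i` corresponds to `e_i`, so the `i`-th multiplicity of `g c` is, up to the factor
`r - 1`, the pairing of `c` with `g⁻¹ e_i`, and no separate lattice of divisors is needed.

The positivity theorem for roots (`SimplyLaced.wordProd_root_mem`) shows that an antidominant class,
that is, one which is sorted and Cremona reduced, is moved by `W` only by adding non-negative
combinations of simple roots (`IsAntidominant.apply_sub_mem`). Hence a Cremona reduced class with
non-negative multiplicities keeps a non-negative last multiplicity, once sorted, along its whole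
orbit. The orbit of a line contains `φ (h - e_1 - e_2)`, which has multiplicities `-1`, so Weyl line
classes with non-negative multiplicities are not Cremona reduced
(`IsWeylLineClass.not_isCremonaReduced`).

For the algorithm, the difficulty is to see that a step creates no negative multiplicity. The main
ingredient is sign coherence (`IsWeylLineClass.mult_nonneg_or_nonpos`): the multiplicities of a Weyl
line class are all non-negative or all non-positive. If `g (h - e_1 - e_2)` had multiplicities of
both signs, at `i` and `j`, a positive combination `F` of `g⁻¹ e_i` and `g⁻¹ e_j` would be orthogonal
to the line. Minimising the degree of `F` under the stabilizer of the line leads to a contradiction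
with an inequality of Noether type (`noether_inequality`), which uses that the classes in the orbit
of the `e_i` have multiplicities between `0` and the degree of the corresponding divisor
(`eq_or_mult_apply_e_nonneg`, `mult_apply_e_le`). For `s = r + 1` sign coherence follows from the
Cauchy-Schwarz inequality.

Writing `d = 1 + (r - 1) k`, the invariants give `∑ m_i = 2 + (r + 1) k` and
`∑ m_i ^ 2 = 2 + 2 k + (r - 1) k ^ 2` (`IsWeylLineClass.numerics`). By the Cauchy-Schwarz inequality
a class with `k ≥ 1` has at least `r + 3` non-zero multiplicities, so a step applied when `k ≥ 2`
cannot make all multiplicities non-positive, nor can it reach a line; it therefore ends in a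
class of the same kind with a smaller `k ≥ 1`. When `k = 1`, the numerics leave only the class of the
rational normal curve.
-/

/-! ### Positivity for simply laced reflection groups -/

namespace SimplyLaced

variable {ι V : Type*} [AddCommGroup V] {x : ι → V} {f : ι → Module.Dual ℤ V}

/-- The product of the reflections `y ↦ y - f i y • x i` along a word in the index set. -/
def wordProd (h2 : ∀ i, f i (x i) = 2) (w : List ι) : V ≃ₗ[ℤ] V :=
  (w.map fun i => Module.reflection (h2 i)).prod

/-- `w` is a reduced word (the first condition), and multiplying its product by the `i`-th
reflection on the right does not shorten it (the second condition). -/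
def IsMinimal (h2 : ∀ i, f i (x i) = 2) (w : List ι) (i : ι) : Prop :=
  (∀ w', wordProd h2 w' = wordProd h2 w → w.length ≤ w'.length) ∧
    ∀ w', wordProd h2 w' = wordProd h2 w * Module.reflection (h2 i) → w.length ≤ w'.length

theorem wordProd_concat (h2 : ∀ i, f i (x i) = 2) (w : List ι) (i : ι) :
    wordProd h2 (w ++ [i]) = wordProd h2 w * Module.reflection (h2 i) := by
  simp [wordProd]

theorem reflection_mul_self (h2 : ∀ i, f i (x i) = 2) (i : ι) :
    Module.reflection (h2 i) * Module.reflection (h2 i) = 1 := by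
  ext y
  exact Module.involutive_reflection (h2 i) y

theorem reflection_comm (h2 : ∀ i, f i (x i) = 2) {i j : ι}
    (hij : f i (x j) = 0) (hji : f j (x i) = 0) :
    Module.reflection (h2 i) * Module.reflection (h2 j)
      = Module.reflection (h2 j) * Module.reflection (h2 i) := by
  ext y
  simp only [LinearEquiv.mul_apply, Module.reflection_apply, map_sub, map_smul, hij, hji]
  module

theorem reflection_braid (h2 : ∀ i, f i (x i) = 2) {i j : ι}
    (hij : f i (x j) = -1) (hji : f j (x i) = -1) :
    Module.reflection (h2 i) * Module.reflection (h2 j) * Module.reflection (h2 i)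
      = Module.reflection (h2 j) * Module.reflection (h2 i) * Module.reflection (h2 j) := by
  ext y
  simp only [LinearEquiv.mul_apply, Module.reflection_apply, map_sub, map_smul, hij, hji,
    h2]
  module

/-- The positivity theorem for roots: if the `i`-th reflection does not shorten the
element on the right, this element maps the `i`-th simple root to a non-negative combination of
simple roots. The induction peels off the last letter `j` of `w` and works in the dihedral group
of `i` and `j`. -/
theorem wordProd_root_mem (h2 : ∀ i, f i (x i) = 2)
    (hsl : ∀ i j, i ≠ j → (f i (x j) = 0 ∧ f j (x i) = 0) ∨ (f i (x j) = -1 ∧ f j (x i) = -1)) :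
    ∀ (n : ℕ) (w : List ι) (i : ι), w.length = n → IsMinimal h2 w i →
      wordProd h2 w (x i) ∈ AddSubmonoid.closure (Set.range x) := by
  intro n
  induction n using Nat.strong_induction_on with
  | _ n ih =>
  intro w i hw hmin
  rcases List.eq_nil_or_concat w with rfl | ⟨u, j, rfl⟩
  · simpa [wordProd] using AddSubmonoid.subset_closure (Set.mem_range_self i)
  rw [List.concat_eq_append] at *
  simp only [IsMinimal, wordProd_concat, List.length_append, List.length_singleton] at hmin hw
  obtain ⟨hm1, hm2⟩ := hmin
  have happ : ∀ y, wordProd h2 (u ++ [j]) y = wordProd h2 u (Module.reflection (h2 j) y) :=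
    fun y => by rw [wordProd_concat, LinearEquiv.mul_apply]
  have hured : ∀ w', wordProd h2 w' = wordProd h2 u → u.length ≤ w'.length := by
    intro w' hw'
    have := hm1 (w' ++ [j]) (by rw [wordProd_concat, hw'])
    simpa using this
  have hij : i ≠ j := by
    rintro rfl
    have := hm2 u (by rw [mul_assoc, reflection_mul_self, mul_one])
    omega
  rcases hsl i j hij with ⟨h1, h1'⟩ | ⟨h1, h1'⟩
  · rw [happ, Module.reflection_apply, h1', zero_smul, sub_zero]
    refine ih u.length (by omega) u i rfl ⟨hured, fun w' hw' => ?_⟩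
    have := hm2 (w' ++ [j])
      (by rw [wordProd_concat, hw', mul_assoc, reflection_comm h2 h1 h1', mul_assoc])
    simpa using this
  · have huj : IsMinimal h2 u j := ⟨hured, fun w' hw' => by have := hm1 w' hw'; omega⟩
    -- If `u` can be shortened by `i`, the element is `v sᵢ sⱼ`, and `sᵢ sⱼ` maps the root `i` to `j`.
    by_cases hui : IsMinimal h2 u i
    · rw [happ, Module.reflection_apply, h1', neg_smul, one_smul, sub_neg_eq_add, map_add]
      exact add_mem (ih u.length (by omega) u i rfl hui) (ih u.length (by omega) u j rfl huj)
    · have : ∃ v, wordProd h2 v = wordProd h2 u * Module.reflection (h2 i) ∧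
          v.length < u.length := by
        by_contra hcon
        push Not at hcon
        exact hui ⟨hured, hcon⟩
      obtain ⟨v, hv, hvl⟩ := this
      have hu : wordProd h2 u = wordProd h2 v * Module.reflection (h2 i) := by
        rw [hv, mul_assoc, reflection_mul_self, mul_one]
      have hlen : ∀ v', wordProd h2 v' = wordProd h2 v → u.length + 1 ≤ v'.length + 2 := by
        intro v' hv'
        have := hm1 (v' ++ [i] ++ [j]) (by rw [wordProd_concat, wordProd_concat, hv', hu])
        simpa using this
      have hvl' := hlen v rfl
      have hvj : IsMinimal h2 v j := by
        refine ⟨fun v' hv' => by have := hlen v' hv'; omega, fun v' hv' => ?_⟩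
        have := hm2 (v' ++ [i] ++ [j]) (by
          rw [wordProd_concat, wordProd_concat, hv', hu]
          simp only [mul_assoc]
          congr 1
          simpa only [mul_assoc] using (reflection_braid h2 h1 h1').symm)
        simp at this
        omega
      have := ih v.length (by omega) v j rfl hvj
      rw [happ, Module.reflection_apply, h1', hu, LinearEquiv.mul_apply]
      convert this using 2
      rw [neg_smul, one_smul, sub_neg_eq_add, map_add, Module.reflection_apply_self,
        Module.reflection_apply, h1]
      module

theorem exists_wordProd_of_mem_closure (h2 : ∀ i, f i (x i) = 2) {g : V ≃ₗ[ℤ] V}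
    (hg : g ∈ Subgroup.closure (Set.range fun i => Module.reflection (h2 i))) :
    ∃ w, wordProd h2 w = g := by
  induction hg using Subgroup.closure_induction with
  | mem g hg =>
    obtain ⟨i, rfl⟩ := hg
    exact ⟨[i], by simp [wordProd]⟩
  | one => exact ⟨[], by simp [wordProd]⟩
  | mul a b _ _ ha hb =>
    obtain ⟨u, rfl⟩ := ha
    obtain ⟨v, rfl⟩ := hb
    exact ⟨u ++ v, by simp [wordProd]⟩
  | inv a hmem ha =>
    clear hmem
    obtain ⟨u, rfl⟩ := ha
    refine ⟨u.reverse, ?_⟩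
    induction u with
    | nil => simp [wordProd]
    | cons i u ih =>
      rw [List.reverse_cons, wordProd_concat, ih, wordProd, wordProd, List.map_cons,
        List.prod_cons, mul_inv_rev]
      exact congrArg _ (eq_inv_of_mul_eq_one_left (reflection_mul_self h2 i))

/-- A vector `y` in the antidominant chamber is the lowest one of its orbit: the group
moves it by non-negative combinations of simple roots. -/
theorem apply_sub_mem (h2 : ∀ i, f i (x i) = 2)
    (hsl : ∀ i j, i ≠ j → (f i (x j) = 0 ∧ f j (x i) = 0) ∨ (f i (x j) = -1 ∧ f j (x i) = -1))
    {y : V} (hy : ∀ i, f i y ≤ 0) {g : V ≃ₗ[ℤ] V}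
    (hg : g ∈ Subgroup.closure (Set.range fun i => Module.reflection (h2 i))) :
    g y - y ∈ AddSubmonoid.closure (Set.range x) := by
  obtain ⟨w, rfl⟩ := exists_wordProd_of_mem_closure h2 hg
  clear hg
  generalize hn : w.length = n
  induction n using Nat.strong_induction_on generalizing w with
  | _ n ih =>
  by_cases hred : ∀ w', wordProd h2 w' = wordProd h2 w → w.length ≤ w'.length
  · rcases List.eq_nil_or_concat w with rfl | ⟨u, j, rfl⟩
    · simp [wordProd]
    rw [List.concat_eq_append] at *
    simp only [wordProd_concat, List.length_append, List.length_singleton] at hred hn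
    have hmin : IsMinimal h2 u j := by
      refine ⟨fun w' hw' => ?_, fun w' hw' => by have := hred w' hw'; omega⟩
      have := hred (w' ++ [j]) (by rw [wordProd_concat, hw'])
      simpa using this
    have h1 := ih u.length (by omega) u rfl
    have h3 := wordProd_root_mem h2 hsl _ u j rfl hmin
    obtain ⟨k, hk⟩ := Int.eq_ofNat_of_zero_le (neg_nonneg.mpr (hy j))
    have : wordProd h2 (u ++ [j]) y - y
        = (wordProd h2 u y - y) + k • wordProd h2 u (x j) := by
      rw [wordProd_concat, LinearEquiv.mul_apply, Module.reflection_apply, map_sub, map_smul,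
        ← natCast_zsmul, ← hk]
      module
    rw [this]
    exact add_mem h1 (nsmul_mem h3 k)
  · push Not at hred
    obtain ⟨w', hw', hlt⟩ := hred
    rw [← hw']
    exact ih w'.length (by omega) w' rfl

end SimplyLaced

/-! ### The invariant form and the simple roots of the lattice of curve classes -/

namespace CremonaCurve

open CurveClass

section Lattice

variable {s : ℕ}

theorem deg_add (c c' : CurveClass s) : (c + c').deg = c.deg + c'.deg := rfl

theorem mult_add (c c' : CurveClass s) (i : Fin s) :
    (c + c').mult i = c.mult i + c'.mult i := rfl

theorem deg_smul (k : ℤ) (c : CurveClass s) : (k • c).deg = k * c.deg := rfl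

theorem mult_smul (k : ℤ) (c : CurveClass s) (i : Fin s) :
    (k • c).mult i = k * c.mult i := rfl

theorem CurveClass.ext' {c c' : CurveClass s} (hd : c.deg = c'.deg)
    (hm : ∀ i, c.mult i = c'.mult i) : c = c' :=
  Prod.ext hd (funext hm)

theorem deg_e (i : Fin s) : (e i).deg = 0 := rfl

theorem mult_e (i j : Fin s) : (e i).mult j = if j = i then -1 else 0 := by
  simp [e, mult, Pi.single_apply, apply_ite Neg.neg]

theorem deg_permEquiv (σ : Equiv.Perm (Fin s)) (c : CurveClass s) :
    (permEquiv σ c).deg = c.deg := rfl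

theorem mult_permEquiv (σ : Equiv.Perm (Fin s)) (c : CurveClass s) (i : Fin s) :
    (permEquiv σ c).mult i = c.mult (σ.symm i) := rfl

theorem permEquiv_mul (σ τ : Equiv.Perm (Fin s)) :
    permEquiv (σ * τ) = permEquiv σ * permEquiv τ := rfl

/-- The curve class `(r - 1) h - ∑ i ∈ I, e_i`; the transformation `φ_I` is the reflection
`c ↦ c + t • cremonaRoot r I`. -/
def cremonaRoot (r : ℕ) (I : Finset (Fin s)) : CurveClass s :=
  ((r : ℤ) - 1, fun i => if i ∈ I then 1 else 0)

theorem deg_cremonaRoot (r : ℕ) (I : Finset (Fin s)) : (cremonaRoot r I).deg = (r : ℤ) - 1 := rfl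

theorem mult_cremonaRoot (r : ℕ) (I : Finset (Fin s)) (i : Fin s) :
    (cremonaRoot r I).mult i = if i ∈ I then 1 else 0 := rfl

theorem cremona_eq_add (r : ℕ) (I : Finset (Fin s)) (c : CurveClass s) :
    cremona r I c = c + excess I c • cremonaRoot r I := by
  refine CurveClass.ext' ?_ fun i => ?_
  · simp only [deg_add, deg_smul, deg_cremonaRoot]
    rw [mul_comm]
    rfl
  · rw [mult_add, mult_smul, mult_cremonaRoot]
    by_cases hi : i ∈ I <;> simp [cremona, mult, hi]

theorem deg_cremona (r : ℕ) (I : Finset (Fin s)) (c : CurveClass s) :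
    (cremona r I c).deg = c.deg + ((r : ℤ) - 1) * excess I c := rfl

theorem mult_cremona (r : ℕ) (I : Finset (Fin s)) (c : CurveClass s) (i : Fin s) :
    (cremona r I c).mult i = if i ∈ I then c.mult i + excess I c else c.mult i := rfl

/-- The symmetric bilinear form on curve classes that is preserved by the Weyl group. -/
def form (r : ℕ) (c c' : CurveClass s) : ℤ :=
  c.deg * c'.deg - ((r : ℤ) - 1) * ∑ i, c.mult i * c'.mult i

theorem form_comm (r : ℕ) (c c' : CurveClass s) : form r c c' = form r c' c := by
  simp only [form, mul_comm]

theorem form_add_left (r : ℕ) (a b c : CurveClass s) :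
    form r (a + b) c = form r a c + form r b c := by
  simp only [form, deg_add, mult_add, add_mul, Finset.sum_add_distrib]
  ring

theorem form_smul_left (r : ℕ) (k : ℤ) (a c : CurveClass s) :
    form r (k • a) c = k * form r a c := by
  simp only [form, deg_smul, mult_smul, mul_assoc, ← Finset.mul_sum]
  ring

theorem form_add_right (r : ℕ) (a b c : CurveClass s) :
    form r a (b + c) = form r a b + form r a c := by
  rw [form_comm, form_add_left, form_comm r b, form_comm r c]

theorem form_smul_right (r : ℕ) (k : ℤ) (a c : CurveClass s) :
    form r a (k • c) = k * form r a c := by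
  rw [form_comm, form_smul_left, form_comm]

theorem form_e_left (r : ℕ) (i : Fin s) (c : CurveClass s) :
    form r (e i) c = ((r : ℤ) - 1) * c.mult i := by
  simp [form, deg_e, mult_e]

theorem form_cremonaRoot_left (r : ℕ) (I : Finset (Fin s)) (c : CurveClass s) :
    form r (cremonaRoot r I) c = ((r : ℤ) - 1) * excess I c := by
  simp only [form, excess, deg_cremonaRoot, mult_cremonaRoot, ite_mul, one_mul, zero_mul,
    Finset.sum_ite_mem, Finset.univ_inter]
  ring

theorem excess_cremonaRoot (r : ℕ) (I : Finset (Fin s)) (hI : I.card = r + 1) :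
    excess I (cremonaRoot r I) = -2 := by
  simp only [excess, deg_cremonaRoot, mult_cremonaRoot, Finset.sum_ite_mem, Finset.inter_self,
    Finset.sum_const, hI]
  push_cast [nsmul_eq_mul]
  ring

theorem form_cremona (r : ℕ) (I : Finset (Fin s)) (hI : I.card = r + 1) (c c' : CurveClass s) :
    form r (cremona r I c) (cremona r I c') = form r c c' := by
  simp only [cremona_eq_add, form_add_left, form_add_right, form_smul_left, form_smul_right,
    form_cremonaRoot_left, form_comm r c (cremonaRoot r I), excess_cremonaRoot r I hI]
  ring

theorem form_permEquiv (r : ℕ) (σ : Equiv.Perm (Fin s)) (c c' : CurveClass s) :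
    form r (permEquiv σ c) (permEquiv σ c') = form r c c' := by
  simp only [form, deg_permEquiv, mult_permEquiv]
  rw [Equiv.sum_comp σ.symm fun i => c.mult i * c'.mult i]

variable {r : ℕ}

theorem cremonaEquiv_mem (I : Finset (Fin s)) (hI : I.card = r + 1) :
    cremonaEquiv r I hI ∈ weylGroup r s :=
  Subgroup.subset_closure (Or.inl ⟨I, hI, rfl⟩)

theorem permEquiv_mem (σ : Equiv.Perm (Fin s)) : permEquiv σ ∈ weylGroup r s :=
  Subgroup.subset_closure (Or.inr ⟨σ, rfl⟩)

theorem cremonaEquiv_apply (I : Finset (Fin s)) (hI : I.card = r + 1) (c : CurveClass s) :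
    cremonaEquiv r I hI c = cremona r I c := rfl

theorem form_apply_apply {g : CurveClass s ≃ₗ[ℤ] CurveClass s} (hg : g ∈ weylGroup r s)
    (c c' : CurveClass s) : form r (g c) (g c') = form r c c' := by
  induction hg using Subgroup.closure_induction generalizing c c' with
  | mem g hg =>
    rcases hg with ⟨I, hI, rfl⟩ | ⟨σ, rfl⟩
    · exact form_cremona r I hI c c'
    · exact form_permEquiv r σ c c'
  | one => rfl
  | mul a b _ _ ha hb => rw [LinearEquiv.mul_apply, LinearEquiv.mul_apply, ha, hb]
  | inv a _ ha =>
    rw [← ha]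
    simp

/-- `form r (g c) c' = form r c (g⁻¹ c')` for `g` in the Weyl group. -/
theorem form_apply_left {g : CurveClass s ≃ₗ[ℤ] CurveClass s} (hg : g ∈ weylGroup r s)
    (c c' : CurveClass s) : form r (g c) c' = form r c (g⁻¹ c') := by
  rw [← form_apply_apply hg c (g⁻¹ c'), ← LinearEquiv.mul_apply, mul_inv_cancel]
  rfl

/-- The class `(r + 1) h - ∑ i, e_i`, a multiple of which corresponds to the anticanonical class
of the blowup under the invariant form; it is fixed by the Weyl group. -/
def anticanonical (r s : ℕ) : CurveClass s := ((r : ℤ) + 1, fun _ => 1)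

theorem form_anticanonical (c : CurveClass s) :
    form r c (anticanonical r s) = ((r : ℤ) + 1) * c.deg - ((r : ℤ) - 1) * ∑ i, c.mult i := by
  simp [form, anticanonical, deg, mult, mul_comm]

theorem apply_anticanonical {g : CurveClass s ≃ₗ[ℤ] CurveClass s} (hg : g ∈ weylGroup r s) :
    g (anticanonical r s) = anticanonical r s := by
  induction hg using Subgroup.closure_induction with
  | mem g hg =>
    rcases hg with ⟨I, hI, rfl⟩ | ⟨σ, rfl⟩
    · have : excess I (anticanonical r s) = 0 := by
        simp [excess, anticanonical, deg, mult, hI]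
      rw [cremonaEquiv_apply, cremona_eq_add, this, zero_smul, add_zero]
    · rfl
  | one => rfl
  | mul a b _ _ ha hb => rw [LinearEquiv.mul_apply, hb, ha]
  | inv a _ ha =>
    nth_rw 1 [← ha]
    simp [← LinearEquiv.mul_apply]

theorem form_apply_anticanonical {g : CurveClass s ≃ₗ[ℤ] CurveClass s}
    (hg : g ∈ weylGroup r s) (c : CurveClass s) :
    form r (g c) (anticanonical r s) = form r c (anticanonical r s) := by
  rw [← form_apply_apply hg c, apply_anticanonical hg]

theorem dvd_deg_apply_sub {g : CurveClass s ≃ₗ[ℤ] CurveClass s} (hg : g ∈ weylGroup r s)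
    (c : CurveClass s) : (r : ℤ) - 1 ∣ (g c).deg - c.deg := by
  induction hg using Subgroup.closure_induction generalizing c with
  | mem g hg =>
    rcases hg with ⟨I, hI, rfl⟩ | ⟨σ, rfl⟩
    · rw [cremonaEquiv_apply, deg_cremona, add_sub_cancel_left]
      exact dvd_mul_right _ _
    · simp [deg_permEquiv]
  | one => simp
  | mul a b _ _ ha hb =>
    have := dvd_add (ha (b c)) (hb c)
    rwa [sub_add_sub_cancel] at this
  | inv a _ ha =>
    have := ha (a⁻¹ c)
    rw [← LinearEquiv.mul_apply, mul_inv_cancel, ← dvd_neg, neg_sub] at this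
    exact this

end Lattice

section Simple

variable {n : ℕ}

/-- The simple roots: `(r - 1) h - e_1 - ⋯ - e_{r+1}` and the differences `e_i - e_{i+1}`. -/
def simpleRoot (r : ℕ) : Option (Fin n) → CurveClass (n + 1)
  | none => cremonaRoot r (firstIndices (n + 1) (r + 1))
  | some i => e i.castSucc - e i.succ

/-- The simple coroots, normalised to take the value `2` on the corresponding simple
root. -/
def simpleCoroot (r : ℕ) : Option (Fin n) → Module.Dual ℤ (CurveClass (n + 1))
  | none =>
    { toFun := fun c => -excess (firstIndices (n + 1) (r + 1)) c
      map_add' := fun c c' => by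
        simp only [excess, deg_add, mult_add, Finset.sum_add_distrib]
        ring
      map_smul' := fun k c => by
        simp only [excess, deg_smul, mult_smul, ← Finset.mul_sum, RingHom.id_apply, smul_eq_mul]
        ring }
  | some i =>
    { toFun := fun c => c.mult i.succ - c.mult i.castSucc
      map_add' := fun c c' => by
        simp only [mult_add]
        ring
      map_smul' := fun k c => by
        simp only [mult_smul, RingHom.id_apply, smul_eq_mul]
        ring }

theorem simpleCoroot_none (r : ℕ) (c : CurveClass (n + 1)) :
    simpleCoroot r none c = -excess (firstIndices (n + 1) (r + 1)) c := rfl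

theorem simpleCoroot_some (r : ℕ) (i : Fin n) (c : CurveClass (n + 1)) :
    simpleCoroot r (some i) c = c.mult i.succ - c.mult i.castSucc := rfl

theorem mem_firstIndices {s k : ℕ} {i : Fin s} : i ∈ firstIndices s k ↔ i.val < k := by
  simp [firstIndices]

theorem card_firstIndices {s k : ℕ} (hk : k ≤ s) : (firstIndices s k).card = k := by
  have : firstIndices s k = Finset.univ.map (Fin.castLEEmb hk) := by
    ext i
    simp only [mem_firstIndices, Finset.mem_map, Finset.mem_univ, true_and, Fin.castLEEmb_apply]
    exact ⟨fun hi => ⟨⟨i, hi⟩, rfl⟩, fun ⟨j, hj⟩ => hj ▸ j.2⟩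
  rw [this, Finset.card_map, Finset.card_univ, Fintype.card_fin]

theorem mult_simpleRoot_some (r : ℕ) (i : Fin n) (j : Fin (n + 1)) :
    (simpleRoot r (some i)).mult j
      = (if j = i.succ then 1 else 0) - (if j = i.castSucc then 1 else 0) := by
  have : (simpleRoot r (some i)).mult j = (e i.castSucc).mult j - (e i.succ).mult j := rfl
  rw [this, mult_e, mult_e]
  split_ifs <;> simp

theorem deg_simpleRoot_some (r : ℕ) (i : Fin n) : (simpleRoot r (some i)).deg = 0 := rfl

theorem simpleCoroot_simpleRoot_self {r : ℕ} (hrn : r ≤ n) (i : Option (Fin n)) :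
    simpleCoroot r i (simpleRoot r i) = 2 := by
  cases i with
  | none =>
    rw [simpleCoroot_none, simpleRoot, excess_cremonaRoot _ _ (card_firstIndices (by omega))]
    rfl
  | some i =>
    have h1 : i.succ ≠ i.castSucc := (Fin.castSucc_lt_succ).ne'
    simp [simpleCoroot_some, mult_simpleRoot_some, h1, h1.symm]

theorem simpleCoroot_some_none (r : ℕ) (i : Fin n) :
    simpleCoroot r (some i) (simpleRoot r none) = if i.val = r then -1 else 0 := by
  rw [simpleCoroot_some, simpleRoot, mult_cremonaRoot, mult_cremonaRoot]
  simp only [mem_firstIndices, Fin.val_succ, Fin.val_castSucc]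
  split_ifs <;> omega

theorem simpleCoroot_none_some (r : ℕ) (i : Fin n) :
    simpleCoroot r none (simpleRoot r (some i)) = if i.val = r then -1 else 0 := by
  simp only [simpleCoroot_none, excess, deg_simpleRoot_some, mult_simpleRoot_some,
    Finset.sum_sub_distrib, Finset.sum_ite_eq', mem_firstIndices, Fin.val_succ, Fin.val_castSucc]
  split_ifs <;> omega

theorem simplyLaced_simpleRoot (r : ℕ) (i j : Option (Fin n)) (hij : i ≠ j) :
    (simpleCoroot r i (simpleRoot r j) = 0 ∧ simpleCoroot r j (simpleRoot r i) = 0) ∨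
      (simpleCoroot r i (simpleRoot r j) = -1 ∧ simpleCoroot r j (simpleRoot r i) = -1) := by
  rcases i with _ | i <;> rcases j with _ | j
  · exact absurd rfl hij
  · rw [simpleCoroot_some_none, simpleCoroot_none_some]
    split_ifs <;> simp
  · rw [simpleCoroot_some_none, simpleCoroot_none_some]
    split_ifs <;> simp
  · have hne : i.val ≠ j.val := fun h => hij (congrArg some (Fin.ext h))
    simp only [simpleCoroot_some, mult_simpleRoot_some, Fin.ext_iff, Fin.val_succ,
      Fin.val_castSucc]
    split_ifs <;> omega

theorem reflection_none {r : ℕ} (hrn : r ≤ n) :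
    Module.reflection (simpleCoroot_simpleRoot_self hrn none)
      = cremonaEquiv r (firstIndices (n + 1) (r + 1)) (card_firstIndices (by omega)) := by
  ext1 c
  rw [Module.reflection_apply, simpleCoroot_none, cremonaEquiv_apply, cremona_eq_add, neg_smul,
    sub_neg_eq_add]
  rfl

theorem reflection_some {r : ℕ} (hrn : r ≤ n) (i : Fin n) :
    Module.reflection (simpleCoroot_simpleRoot_self hrn (some i))
      = permEquiv (Equiv.swap i.castSucc i.succ) := by
  ext1 c
  rw [Module.reflection_apply, simpleCoroot_some, sub_eq_add_neg, ← neg_smul]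
  have h1 : i.succ ≠ i.castSucc := (Fin.castSucc_lt_succ).ne'
  refine CurveClass.ext' ?_ fun j => ?_
  · rw [deg_add, deg_smul, deg_simpleRoot_some, mul_zero, add_zero, deg_permEquiv]
  · rw [mult_add, mult_smul, mult_simpleRoot_some, mult_permEquiv, Equiv.symm_swap,
      Equiv.swap_apply_def]
    split_ifs with h2 h3 h3
    · exact absurd (h2.symm.trans h3) h1
    · rw [h2]; ring
    · rw [h3]; ring
    · ring

theorem exists_perm_map_eq {s : ℕ} {I J : Finset (Fin s)} (h : I.card = J.card) :
    ∃ σ : Equiv.Perm (Fin s), ∀ i, σ i ∈ J ↔ i ∈ I := by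
  let E : {i // i ∈ I} ≃ {i // i ∈ J} := Finset.equivOfCardEq h
  refine ⟨E.extendSubtype, fun i => ⟨fun hi => ?_, E.extendSubtype_mem i⟩⟩
  by_contra hn
  exact E.extendSubtype_not_mem i hn hi

theorem permEquiv_cremona {s : ℕ} (r : ℕ) {I J : Finset (Fin s)} (σ : Equiv.Perm (Fin s))
    (hσ : ∀ i, σ i ∈ J ↔ i ∈ I) (c : CurveClass s) :
    permEquiv σ (cremona r I c) = cremona r J (permEquiv σ c) := by
  have hex : excess J (permEquiv σ c) = excess I c := by
    simp only [excess, deg_permEquiv, mult_permEquiv]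
    congr 1
    refine (Finset.sum_bij (fun i _ => σ i) (fun i hi => (hσ i).mpr hi)
      (fun _ _ _ _ hij => σ.injective hij) (fun j hj => ⟨σ.symm j, ?_, by simp⟩) ?_).symm
    · rw [← hσ]; simpa using hj
    · intro i _; simp
  refine CurveClass.ext' ?_ fun j => ?_
  · rw [deg_permEquiv, deg_cremona, deg_cremona, hex, deg_permEquiv]
  · have : σ.symm j ∈ I ↔ j ∈ J := by rw [← hσ]; simp
    rw [mult_permEquiv, mult_cremona, mult_cremona, hex, mult_permEquiv]
    simp only [this]

/-- The Weyl group is generated by the simple reflections. -/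
theorem weylGroup_le_closure {r : ℕ} (hrn : r ≤ n) :
    weylGroup r (n + 1) ≤ Subgroup.closure
      (Set.range fun i => Module.reflection (simpleCoroot_simpleRoot_self hrn i)) := by
  have hperm : ∀ σ : Equiv.Perm (Fin (n + 1)), permEquiv σ ∈ Subgroup.closure
      (Set.range fun i => Module.reflection (simpleCoroot_simpleRoot_self hrn i)) := by
    intro σ
    have hσ : σ ∈ Submonoid.closure
        (Set.range fun i : Fin n => Equiv.swap i.castSucc i.succ) := by
      rw [Equiv.Perm.mclosure_swap_castSucc_succ]
      trivial
    induction hσ using Submonoid.closure_induction with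
    | mem σ hσ =>
      obtain ⟨i, rfl⟩ := hσ
      exact Subgroup.subset_closure ⟨some i, reflection_some hrn i⟩
    | one => exact one_mem _
    | mul a b _ _ ha hb => exact mul_mem ha hb
  refine (Subgroup.closure_le _).mpr ?_
  rintro g (⟨I, hI, rfl⟩ | ⟨σ, rfl⟩)
  · have hc : (firstIndices (n + 1) (r + 1)).card = r + 1 := card_firstIndices (by omega)
    obtain ⟨σ, hσ⟩ := exists_perm_map_eq (hc.trans hI.symm)
    have : cremonaEquiv r I hI = permEquiv σ * cremonaEquiv r _ hc * (permEquiv σ)⁻¹ := by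
      rw [eq_mul_inv_iff_mul_eq]
      ext1 c
      exact (permEquiv_cremona r σ hσ c).symm
    rw [this]
    exact mul_mem (mul_mem (hperm σ) (Subgroup.subset_closure ⟨none, reflection_none hrn⟩))
      (inv_mem (hperm σ))
  · exact hperm σ

end Simple

end CremonaCurve

/-! ### Orbits of antidominant classes -/

namespace CremonaCurve

open CurveClass

section Antidominant

variable {n r : ℕ}

/-- The closed antidominant chamber: the multiplicities are sorted in non-increasing order and
`φ` does not lower the degree. -/
def IsAntidominant (r : ℕ) {s : ℕ} (y : CurveClass s) : Prop :=
  0 ≤ excess (firstIndices s (r + 1)) y ∧ Antitone y.mult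

theorem isAntidominant_iff {y : CurveClass (n + 1)} :
    IsAntidominant r y ↔ ∀ i, simpleCoroot r i y ≤ 0 := by
  rw [IsAntidominant, Fin.antitone_iff_succ_le]
  refine ⟨fun ⟨h1, h2⟩ i => ?_, fun h => ⟨by simpa [simpleCoroot_none] using h none, fun i => ?_⟩⟩
  · cases i with
    | none => simpa [simpleCoroot_none] using h1
    | some i => simpa [simpleCoroot_some] using h2 i
  · simpa [simpleCoroot_some] using h (some i)

theorem IsAntidominant.apply_sub_mem (hrn : r ≤ n) {y : CurveClass (n + 1)}
    (hy : IsAntidominant r y) {g : CurveClass (n + 1) ≃ₗ[ℤ] CurveClass (n + 1)}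
    (hg : g ∈ weylGroup r (n + 1)) :
    g y - y ∈ AddSubmonoid.closure (Set.range (simpleRoot (n := n) r)) :=
  SimplyLaced.apply_sub_mem (simpleCoroot_simpleRoot_self hrn) (simplyLaced_simpleRoot r)
    (isAntidominant_iff.mp hy) (weylGroup_le_closure hrn hg)

/-- A linear functional which is positive on all simple roots. -/
def height {s : ℕ} (v : CurveClass s) : ℤ := ∑ i, (i.val : ℤ) * v.mult i

theorem height_add {s : ℕ} (v w : CurveClass s) : height (v + w) = height v + height w := by
  simp [height, mult_add, mul_add, Finset.sum_add_distrib]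

theorem height_smul {s : ℕ} (k : ℤ) (v : CurveClass s) : height (k • v) = k * height v := by
  simp only [height, mult_smul, Finset.mul_sum]
  exact Finset.sum_congr rfl fun i _ => by ring

theorem height_simpleRoot_pos (hr : 1 ≤ r) (hrn : r ≤ n) (i : Option (Fin n)) :
    0 < height (simpleRoot r i) := by
  cases i with
  | none =>
    refine Finset.sum_pos' (fun j _ => ?_) ⟨⟨1, by omega⟩, Finset.mem_univ _, ?_⟩
    · rw [simpleRoot, mult_cremonaRoot]
      split_ifs <;> simp
    · have : (⟨1, by omega⟩ : Fin (n + 1)) ∈ firstIndices (n + 1) (r + 1) :=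
        mem_firstIndices.mpr (by simp only; omega)
      rw [simpleRoot, mult_cremonaRoot, if_pos this]
      simp
  | some i =>
    simp [height, mult_simpleRoot_some, mul_sub, Finset.sum_sub_distrib]

theorem deg_simpleRoot_nonneg (hr : 1 ≤ r) (i : Option (Fin n)) :
    0 ≤ (simpleRoot r i).deg := by
  cases i with
  | none => rw [simpleRoot, deg_cremonaRoot]; omega
  | some i => rw [deg_simpleRoot_some]

theorem mult_last_simpleRoot_nonneg (i : Option (Fin n)) :
    0 ≤ (simpleRoot r i).mult (Fin.last n) := by
  cases i with
  | none => rw [simpleRoot, mult_cremonaRoot]; split_ifs <;> simp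
  | some i =>
    have : Fin.last n ≠ i.castSucc := (Fin.castSucc_lt_last i).ne'
    rw [mult_simpleRoot_some, if_neg this]
    split_ifs <;> simp

theorem nonneg_of_mem_cone (hr : 1 ≤ r) (hrn : r ≤ n) {v : CurveClass (n + 1)}
    (hv : v ∈ AddSubmonoid.closure (Set.range (simpleRoot (n := n) r))) :
    0 ≤ v.deg ∧ 0 ≤ v.mult (Fin.last n) ∧ (v = 0 ∨ 0 < height v) := by
  induction hv using AddSubmonoid.closure_induction with
  | mem v hv =>
    obtain ⟨i, rfl⟩ := hv
    exact ⟨deg_simpleRoot_nonneg hr i, mult_last_simpleRoot_nonneg i,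
      Or.inr (height_simpleRoot_pos hr hrn i)⟩
  | zero => exact ⟨le_rfl, le_rfl, Or.inl rfl⟩
  | add a b _ _ ha hb =>
    obtain ⟨a1, a2, a3⟩ := ha
    obtain ⟨b1, b2, b3⟩ := hb
    refine ⟨add_nonneg a1 b1, add_nonneg a2 b2, ?_⟩
    rcases a3 with rfl | a3
    · rwa [zero_add]
    · rcases b3 with rfl | b3
      · rw [add_zero]; exact Or.inr a3
      · rw [height_add]; exact Or.inr (add_pos a3 b3)

theorem IsAntidominant.deg_le (hr : 1 ≤ r) (hrn : r ≤ n) {y : CurveClass (n + 1)}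
    (hy : IsAntidominant r y) {g : CurveClass (n + 1) ≃ₗ[ℤ] CurveClass (n + 1)}
    (hg : g ∈ weylGroup r (n + 1)) : y.deg ≤ (g y).deg :=
  sub_nonneg.mp (nonneg_of_mem_cone hr hrn (hy.apply_sub_mem hrn hg)).1

theorem IsAntidominant.mult_last_le (hr : 1 ≤ r) (hrn : r ≤ n) {y : CurveClass (n + 1)}
    (hy : IsAntidominant r y) {g : CurveClass (n + 1) ≃ₗ[ℤ] CurveClass (n + 1)}
    (hg : g ∈ weylGroup r (n + 1)) : y.mult (Fin.last n) ≤ (g y).mult (Fin.last n) :=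
  sub_nonneg.mp (nonneg_of_mem_cone hr hrn (hy.apply_sub_mem hrn hg)).2.1

theorem isAntidominant_e_last : IsAntidominant r (e (Fin.last n)) := by
  constructor
  · simp only [excess, deg_e, mult_e, zero_sub, Finset.sum_ite_eq']
    split_ifs <;> simp
  · intro i j hij
    rw [mult_e, mult_e]
    split_ifs with h1 h2 h2
    · rfl
    · simp
    · exact absurd (Fin.last_le_iff.mp (h2 ▸ hij)) h1
    · rfl

/-- The class `h - e_1`. It pairs non-negatively with the orbit of the `e_i`, which
bounds multiplicities by degrees. -/
theorem isAntidominant_h_sub_e_zero : IsAntidominant r (h - e (0 : Fin (n + 1))) := by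
  have hm : ∀ i, (h - e (0 : Fin (n + 1))).mult i = if i = 0 then 1 else 0 := by
    intro i
    have : (h - e (0 : Fin (n + 1))).mult i = 0 - (e (0 : Fin (n + 1))).mult i := rfl
    rw [this, mult_e]
    split_ifs <;> simp
  have hd : (h - e (0 : Fin (n + 1))).deg = 1 := rfl
  constructor
  · simp only [excess, hd, hm, Finset.sum_ite_eq']
    split_ifs <;> simp
  · intro i j hij
    rw [hm, hm]
    split_ifs with h1 h2 h2
    · rfl
    · exact absurd (Fin.le_zero_iff.mp (h1 ▸ hij)) h2
    · simp
    · rfl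

/-- A class in the orbit of `e_s` other than `e_s` is not antidominant, so a simple reflection
brings it closer to `e_s`; all classes met on the way down from it have a non-negative last
multiplicity, until `e_s` is reached. -/
theorem eq_or_mult_last_nonneg (hr : 1 ≤ r) (hrn : r ≤ n)
    {g : CurveClass (n + 1) ≃ₗ[ℤ] CurveClass (n + 1)} (hg : g ∈ weylGroup r (n + 1)) :
    g (e (Fin.last n)) = e (Fin.last n) ∨ 0 ≤ (g (e (Fin.last n))).mult (Fin.last n) := by
  have hheight : ∀ g ∈ weylGroup r (n + 1),
      0 ≤ height (g (e (Fin.last n)) - e (Fin.last n)) := by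
    intro g hg
    rcases (nonneg_of_mem_cone hr hrn (isAntidominant_e_last.apply_sub_mem hrn hg)).2.2 with h | h
    · rw [h]; simp [height, mult]
    · exact h.le
  generalize hN : (height (g (e (Fin.last n)) - e (Fin.last n))).toNat = N
  induction N using Nat.strong_induction_on generalizing g with
  | _ N ih =>
  by_cases hanti : IsAntidominant r (g (e (Fin.last n)))
  · left
    have h1 := (nonneg_of_mem_cone hr hrn (isAntidominant_e_last.apply_sub_mem hrn hg)).2.2
    have h2 := (nonneg_of_mem_cone hr hrn (hanti.apply_sub_mem hrn (inv_mem hg))).2.2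
    rw [← LinearEquiv.mul_apply, inv_mul_cancel, LinearEquiv.coe_one, id_eq] at h2
    rcases h1 with h1 | h1
    · exact sub_eq_zero.mp h1
    · rcases h2 with h2 | h2
      · exact (sub_eq_zero.mp h2).symm
      · have := add_pos h1 h2
        rw [← height_add, sub_add_sub_cancel, sub_self] at this
        simp [height, mult] at this
  · right
    rw [isAntidominant_iff] at hanti
    push Not at hanti
    obtain ⟨i, hi⟩ := hanti
    have hmem : Module.reflection (simpleCoroot_simpleRoot_self hrn i) ∈ weylGroup r (n + 1) := by
      cases i with
      | none => rw [reflection_none hrn]; exact cremonaEquiv_mem _ _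
      | some i => rw [reflection_some hrn]; exact permEquiv_mem _
    set t := simpleCoroot r i (g (e (Fin.last n))) with ht
    have hrefl : (Module.reflection (simpleCoroot_simpleRoot_self hrn i) * g) (e (Fin.last n))
        = g (e (Fin.last n)) + (-t) • simpleRoot r i := by
      rw [LinearEquiv.mul_apply, Module.reflection_apply, neg_smul, ← sub_eq_add_neg]
    have hmem' := mul_mem hmem hg
    have h1 := hheight _ hmem'
    have h2 := mul_pos hi (height_simpleRoot_pos hr hrn i)
    have h3 : height ((Module.reflection (simpleCoroot_simpleRoot_self hrn i) * g)
        (e (Fin.last n)) - e (Fin.last n))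
        = height (g (e (Fin.last n)) - e (Fin.last n)) - t * height (simpleRoot r i) := by
      rw [hrefl, add_sub_right_comm, height_add, height_smul]
      ring
    have h4 := mult_last_simpleRoot_nonneg (r := r) i
    rcases ih _ (by omega) hmem' rfl with h5 | h5
    · -- Here `g e_s` is the image of `e_s` under a simple reflection that moves `e_s`.
      rw [hrefl] at h5
      have h6 : g (e (Fin.last n)) = e (Fin.last n) + t • simpleRoot r i := by
        rw [neg_smul, ← sub_eq_add_neg] at h5
        exact sub_eq_iff_eq_add.mp h5
      have h7 : t = simpleCoroot r i (e (Fin.last n)) + t * 2 := by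
        conv_lhs => rw [ht, h6, map_add, map_smul, simpleCoroot_simpleRoot_self hrn]
        rfl
      have h8 : 0 < (simpleRoot r i).mult (Fin.last n) := by
        by_contra hcon
        have hzero : (simpleRoot r i).mult (Fin.last n) = 0 := le_antisymm (not_lt.mp hcon) h4
        have : simpleCoroot r i (e (Fin.last n)) = 0 := by
          cases i with
          | none =>
            rw [simpleRoot, mult_cremonaRoot] at hzero
            rw [simpleCoroot_none]
            simp only [excess, deg_e, mult_e, Finset.sum_ite_eq']
            split_ifs at hzero with hl
            · simp at hzero
            · rw [if_neg hl]
              rfl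
          | some i =>
            have hne : Fin.last n ≠ i.castSucc := (Fin.castSucc_lt_last i).ne'
            rw [mult_simpleRoot_some, if_neg hne] at hzero
            have hne' : i.succ ≠ Fin.last n := by
              intro h
              rw [if_pos h.symm] at hzero
              simp at hzero
            rw [simpleCoroot_some, mult_e, mult_e, if_neg hne', if_neg hne.symm]
            simp
        omega
      rw [h6, mult_add, mult_smul, mult_e, if_pos rfl]
      nlinarith
    · rw [hrefl, mult_add, mult_smul] at h5
      nlinarith

theorem apply_e_eq (g : CurveClass (n + 1) ≃ₗ[ℤ] CurveClass (n + 1)) (j : Fin (n + 1)) :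
    g (e j) = (g * permEquiv (Equiv.swap (Fin.last n) j)) (e (Fin.last n)) := by
  rw [LinearEquiv.mul_apply, permEquiv_e, Equiv.swap_apply_left]

theorem deg_apply_e_nonneg (hr : 1 ≤ r) (hrn : r ≤ n)
    {g : CurveClass (n + 1) ≃ₗ[ℤ] CurveClass (n + 1)} (hg : g ∈ weylGroup r (n + 1))
    (j : Fin (n + 1)) : 0 ≤ (g (e j)).deg := by
  rw [apply_e_eq]
  exact isAntidominant_e_last.deg_le hr hrn (mul_mem hg (permEquiv_mem _))

theorem eq_or_mult_apply_e_nonneg (hr : 1 ≤ r) (hrn : r ≤ n)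
    {g : CurveClass (n + 1) ≃ₗ[ℤ] CurveClass (n + 1)} (hg : g ∈ weylGroup r (n + 1))
    (i j : Fin (n + 1)) : g (e j) = e i ∨ 0 ≤ (g (e j)).mult i := by
  rw [apply_e_eq]
  set σ := Equiv.swap (Fin.last n) i
  have := eq_or_mult_last_nonneg hr hrn
    (mul_mem (permEquiv_mem σ) (mul_mem hg (permEquiv_mem (Equiv.swap (Fin.last n) j))))
  rw [LinearEquiv.mul_apply (permEquiv σ), mult_permEquiv, Equiv.symm_swap,
    Equiv.swap_apply_left] at this
  refine this.imp (fun h => ?_) id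
  apply (permEquiv σ).injective
  rw [h, permEquiv_e, Equiv.swap_apply_right]

theorem mult_apply_e_le (hr : 1 ≤ r) (hrn : r ≤ n)
    {g : CurveClass (n + 1) ≃ₗ[ℤ] CurveClass (n + 1)} (hg : g ∈ weylGroup r (n + 1))
    (hn : 1 ≤ n) (i j : Fin (n + 1)) :
    ((r : ℤ) - 1) * (g (e j)).mult i ≤ (g (e j)).deg := by
  rw [apply_e_eq]
  set g' := g * permEquiv (Equiv.swap (Fin.last n) j)
  have hg' : g' ∈ weylGroup r (n + 1) := mul_mem hg (permEquiv_mem _)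
  set σ := Equiv.swap 0 i
  have hmem := mul_mem (permEquiv_mem (r := r) σ) hg'
  have h1 : form r ((permEquiv σ * g') (e (Fin.last n))) (h - e 0)
      = (g' (e (Fin.last n))).deg - ((r : ℤ) - 1) * (g' (e (Fin.last n))).mult i := by
    rw [sub_eq_add_neg, ← neg_one_smul ℤ (e 0), form_add_right, form_smul_right,
      form_comm r _ (e 0), form_e_left, LinearEquiv.mul_apply, mult_permEquiv,
      Equiv.symm_swap, Equiv.swap_apply_left]
    simp [form, h, mult, deg]
    rfl
  rw [form_apply_left hmem, form_e_left] at h1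
  have h2 := isAntidominant_h_sub_e_zero.mult_last_le hr hrn (inv_mem hmem)
  have h3 : (h - e (0 : Fin (n + 1))).mult (Fin.last n) = 0 := by
    have : (h - e (0 : Fin (n + 1))).mult (Fin.last n)
        = 0 - (e (0 : Fin (n + 1))).mult (Fin.last n) := rfl
    rw [this, mult_e, if_neg (by simp [Fin.ext_iff]; omega)]
    rfl
  rw [h3] at h2
  have h4 : (0 : ℤ) ≤ (r : ℤ) - 1 := by omega
  have := mul_nonneg h4 h2
  linarith

end Antidominant

end CremonaCurve

/-! ### Numerical invariants of Weyl line classes -/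

namespace CremonaCurve

open CurveClass

section Numerics

variable {r s : ℕ}

theorem deg_lineClass (hs : 2 ≤ s) : (lineClass s hs).deg = 1 := rfl

theorem mult_lineClass (hs : 2 ≤ s) (i : Fin s) :
    (lineClass s hs).mult i
      = (if i = ⟨0, by omega⟩ then 1 else 0) + (if i = ⟨1, by omega⟩ then 1 else 0) := by
  have : (lineClass s hs).mult i
      = 0 - (e ⟨0, by omega⟩ : CurveClass s).mult i - (e ⟨1, by omega⟩ : CurveClass s).mult i := rfl
  rw [this, mult_e, mult_e]
  split_ifs <;> simp

theorem form_lineClass_right (hs : 2 ≤ s) (c : CurveClass s) :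
    form r c (lineClass s hs)
      = c.deg - ((r : ℤ) - 1) * (c.mult ⟨0, by omega⟩ + c.mult ⟨1, by omega⟩) := by
  simp [form, deg_lineClass, mult_lineClass, mul_add, Finset.sum_add_distrib]

theorem excess_lineClass (hs : 2 ≤ s) (I : Finset (Fin s)) :
    excess I (lineClass s hs)
      = 1 - ((if (⟨0, by omega⟩ : Fin s) ∈ I then 1 else 0)
        + (if (⟨1, by omega⟩ : Fin s) ∈ I then 1 else 0)) := by
  simp only [excess, deg_lineClass, mult_lineClass, Finset.sum_add_distrib, Finset.sum_ite_eq']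

theorem IsWeylLineClass.apply {hs : 2 ≤ s} {c : CurveClass s} (hc : IsWeylLineClass r s hs c)
    {g : CurveClass s ≃ₗ[ℤ] CurveClass s} (hg : g ∈ weylGroup r s) :
    IsWeylLineClass r s hs (g c) := by
  obtain ⟨u, rfl⟩ := hc
  exact ⟨⟨g, hg⟩ * u, rfl⟩

theorem isWeylLineClass_iff {hs : 2 ≤ s} {c : CurveClass s} :
    IsWeylLineClass r s hs c ↔ ∃ g ∈ weylGroup r s, g (lineClass s hs) = c :=
  ⟨fun ⟨u, hu⟩ => ⟨u.1, u.2, hu⟩, fun ⟨g, hg, h⟩ => ⟨⟨g, hg⟩, h⟩⟩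

/-- The two invariants determine the sum and the sum of squares of the multiplicities
of a Weyl line class in terms of `k = (d - 1) / (r - 1)`. -/
theorem IsWeylLineClass.numerics (hr : 2 ≤ r) {hs : 2 ≤ s} {c : CurveClass s}
    (hc : IsWeylLineClass r s hs c) :
    ∃ k : ℤ, c.deg = 1 + ((r : ℤ) - 1) * k ∧ ∑ i, c.mult i = 2 + ((r : ℤ) + 1) * k ∧
      ∑ i, c.mult i * c.mult i = 2 + 2 * k + ((r : ℤ) - 1) * k ^ 2 := by
  obtain ⟨g, hg, rfl⟩ := isWeylLineClass_iff.mp hc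
  obtain ⟨k, hk⟩ := dvd_deg_apply_sub hg (lineClass s hs)
  have hr1 : (r : ℤ) - 1 ≠ 0 := by omega
  have hne : (⟨1, by omega⟩ : Fin s) ≠ ⟨0, by omega⟩ := by simp [Fin.ext_iff]
  have h1 := form_apply_anticanonical hg (lineClass s hs)
  have h2 := form_apply_apply hg (lineClass s hs) (lineClass s hs)
  have h3 : ∑ i, (lineClass s hs).mult i = 2 := by
    simp [mult_lineClass, Finset.sum_add_distrib]
  rw [form_anticanonical, form_anticanonical, h3] at h1
  rw [form_lineClass_right, mult_lineClass, mult_lineClass, if_pos rfl, if_neg hne, if_pos rfl,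
    if_neg hne.symm, form] at h2
  rw [deg_lineClass] at h1 h2 hk
  have hd : (g (lineClass s hs)).deg = 1 + ((r : ℤ) - 1) * k := by linarith
  rw [hd] at h1 h2
  refine ⟨k, hd, mul_left_cancel₀ hr1 ?_, mul_left_cancel₀ hr1 ?_⟩
  · linear_combination -h1
  · linear_combination -h2

theorem deg_sortMult (c : CurveClass s) : (sortMult c).deg = c.deg := rfl

theorem mult_sortMult (c : CurveClass s) (i : Fin s) :
    (sortMult c).mult i = c.mult (Tuple.sort (fun i => -c.mult i) i) := rfl

theorem sortMult_eq_permEquiv (c : CurveClass s) :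
    sortMult c = permEquiv (Tuple.sort fun i => -c.mult i).symm c := rfl

theorem IsWeylLineClass.sortMult {hs : 2 ≤ s} {c : CurveClass s}
    (hc : IsWeylLineClass r s hs c) : IsWeylLineClass r s hs (sortMult c) := by
  rw [sortMult_eq_permEquiv]
  exact hc.apply (permEquiv_mem _)

theorem CurveClass.Nonneg.sortMult {c : CurveClass s} (hc : c.Nonneg) : (sortMult c).Nonneg :=
  ⟨hc.1, fun _ => hc.2 _⟩

theorem sum_mult_sortMult (c : CurveClass s) : ∑ i, (sortMult c).mult i = ∑ i, c.mult i :=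
  Equiv.sum_comp (Tuple.sort fun i => -c.mult i) c.mult

/-- A sorted sequence of zeros and ones with `N` ones starts with the ones. -/
theorem eq_ite_of_antitone {m : Fin s → ℤ} (hm : Antitone m) (h01 : ∀ i, m i = 0 ∨ m i = 1)
    {N : ℕ} (hsum : ∑ i, m i = N) (i : Fin s) : m i = if i.val < N then 1 else 0 := by
  have hcard : (Finset.univ.filter fun j => m j = 1).card = N := by
    have : ∑ j, m j = ∑ j, if m j = 1 then (1 : ℤ) else 0 :=
      Finset.sum_congr rfl fun j _ => by rcases h01 j with h | h <;> simp [h]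
    rw [this, Finset.sum_boole] at hsum
    exact_mod_cast hsum
  rcases h01 i with h | h
  · rw [h, if_neg]
    have hsub : (Finset.univ.filter fun j => m j = 1) ⊆ Finset.Iio i := by
      intro j hj
      rw [Finset.mem_filter] at hj
      rw [Finset.mem_Iio]
      by_contra hij
      have := hm (not_lt.mp hij)
      omega
    have := Finset.card_le_card hsub
    rw [hcard, Fin.card_Iio] at this
    omega
  · rw [h, if_pos]
    have hsub : Finset.Iic i ⊆ (Finset.univ.filter fun j => m j = 1) := by
      intro j hj
      have := hm (Finset.mem_Iic.mp hj)
      rw [Finset.mem_filter]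
      refine ⟨Finset.mem_univ _, ?_⟩
      rcases h01 j with hj | hj <;> omega
    have := Finset.card_le_card hsub
    rw [hcard, Fin.card_Iic] at this
    omega

theorem mul_sub_one_nonneg (m : ℤ) : 0 ≤ m * (m - 1) := by
  rcases le_or_gt m 0 with h | h
  · exact mul_nonneg_of_nonpos_of_nonpos h (by omega)
  · exact mul_nonneg h.le (by omega)

theorem eq_zero_or_one_of_sum_eq {ι : Type*} [Fintype ι] {m : ι → ℤ}
    (h : ∑ i, m i * m i = ∑ i, m i) (i : ι) : m i = 0 ∨ m i = 1 := by
  have h0 : ∑ i, m i * (m i - 1) = 0 := by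
    simp only [mul_sub, mul_one, Finset.sum_sub_distrib, h, sub_self]
  have := (Finset.sum_eq_zero_iff_of_nonneg fun i _ => mul_sub_one_nonneg (m i)).mp h0 i
    (Finset.mem_univ i)
  rcases mul_eq_zero.mp this with h | h
  · exact Or.inl h
  · exact Or.inr (by omega)

/-- By the Cauchy-Schwarz inequality, a class with the numerical invariants of a Weyl line class with
`k ≥ 1` is not supported on `r + 2` or fewer points. -/
theorem add_two_lt_card_of_mult_eq_zero (hr : 2 ≤ r) {c : CurveClass s} {k : ℤ} (hk : 1 ≤ k)
    (h1 : ∑ i, c.mult i = 2 + ((r : ℤ) + 1) * k)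
    (h2 : ∑ i, c.mult i * c.mult i = 2 + 2 * k + ((r : ℤ) - 1) * k ^ 2)
    {J : Finset (Fin s)} (hJ : ∀ i ∉ J, c.mult i = 0) : r + 2 < J.card := by
  by_contra hcon
  have hcs := sq_sum_le_card_mul_sum_sq (s := J) (f := c.mult)
  have e1 : ∑ i ∈ J, c.mult i = ∑ i, c.mult i :=
    Finset.sum_subset (Finset.subset_univ _) fun i _ hi => hJ i hi
  have e2 : ∑ i ∈ J, c.mult i ^ 2 = ∑ i, c.mult i * c.mult i := by
    simp only [sq]
    exact Finset.sum_subset (Finset.subset_univ _) fun i _ hi => by rw [hJ i hi, mul_zero]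
  rw [e1, e2, h1, h2] at hcs
  have hr' : (2 : ℤ) ≤ r := by exact_mod_cast hr
  have hcard : (J.card : ℤ) ≤ r + 2 := by exact_mod_cast not_lt.mp hcon
  have hpos : 0 ≤ 2 + 2 * k + ((r : ℤ) - 1) * k ^ 2 := by
    have := mul_nonneg (show (0 : ℤ) ≤ (r : ℤ) - 1 by linarith) (sq_nonneg k)
    linarith
  have hle := hcs.trans (mul_le_mul_of_nonneg_right hcard hpos)
  -- The difference of the two sides is `(r + 3) k ^ 2 + 2 r k - 2 r`.
  have h3 : 0 ≤ ((r : ℤ) + 3) * (k ^ 2 - 1) :=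
    mul_nonneg (by linarith) (by nlinarith)
  have h4 : 0 ≤ (r : ℤ) * (k - 1) := mul_nonneg (by linarith) (by linarith)
  nlinarith

end Numerics

/-! ### Sign coherence of Weyl line classes -/

section SignCoherence

/-- A set of `k` indices at which `M` takes its `k` largest values. -/
theorem exists_subset_card_largest {α : Type*} [DecidableEq α] (T : Finset α) (M : α → ℤ)
    (k : ℕ) (hk : k ≤ T.card) :
    ∃ J ⊆ T, J.card = k ∧ ∀ j ∈ J, ∀ i ∈ T \ J, M i ≤ M j := by
  induction k with
  | zero => exact ⟨∅, by simp, rfl, by simp⟩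
  | succ k ih =>
    obtain ⟨J, hJT, hJc, hJ⟩ := ih (by omega)
    have hne : (T \ J).Nonempty := by
      rw [← Finset.card_pos, Finset.card_sdiff_of_subset hJT]
      omega
    obtain ⟨a, ha, hmax⟩ := Finset.exists_max_image (T \ J) M hne
    obtain ⟨haT, haJ⟩ := Finset.mem_sdiff.mp ha
    refine ⟨insert a J, Finset.insert_subset haT hJT, by rw [Finset.card_insert_of_notMem haJ, hJc],
      fun j hj i hi => ?_⟩
    obtain ⟨hiT, hia⟩ := Finset.mem_sdiff.mp hi
    rw [Finset.mem_insert, not_or] at hia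
    have hi' : i ∈ T \ J := Finset.mem_sdiff.mpr ⟨hiT, hia.2⟩
    rcases Finset.mem_insert.mp hj with rfl | hj
    · exact hmax i hi'
    · exact hJ j hj i hi'

/-- An inequality of Noether type: a divisor of degree `d` with multiplicities `M i` between `0` and
`d`, of degree `0` on the line through the points `i₁` and `i₂`, with negative square under the
invariant form and non-negative pairing with the anticanonical class, has its degree lowered by
some Cremona transformation based at exactly one of these two points. The proof compares
`∑ M i (M i - a)` with the contributions of `i₁`, `i₂` and the `r` largest other multiplicities, where
`a` is the smallest of these `r`. -/
theorem noether_inequality {r s : ℕ} (hr : 1 ≤ r) (hs : r + 2 ≤ s) {M : Fin s → ℤ} {d p q : ℤ}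
    {i₁ i₂ : Fin s} (hne : i₁ ≠ i₂) (hd : d = M i₁ + M i₂) (h0 : ∀ i, 0 ≤ M i)
    (hle : ∀ i, M i ≤ d)
    (hI : ∀ I : Finset (Fin s), I.card = r + 1 → (i₁ ∈ I ↔ i₂ ∉ I) →
      ∑ i ∈ I, M i ≤ ((r : ℤ) - 1) * d)
    (hsum : ∑ i, M i = ((r : ℤ) + 1) * d - p)
    (hsq : ∑ i, M i * M i = ((r : ℤ) - 1) * d ^ 2 + q) (hp : 0 ≤ p) (hq : 0 < q) : False := by
  set T : Finset (Fin s) := (Finset.univ.erase i₁).erase i₂ with hT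
  have hmem : i₂ ∈ Finset.univ.erase i₁ := Finset.mem_erase.mpr ⟨hne.symm, Finset.mem_univ _⟩
  have hTc : T.card = s - 2 := by
    rw [hT, Finset.card_erase_of_mem hmem, Finset.card_erase_of_mem (Finset.mem_univ _),
      Finset.card_univ, Fintype.card_fin]
    omega
  obtain ⟨J, hJT, hJc, hJ⟩ := exists_subset_card_largest T M r (by omega)
  have hJne : J.Nonempty := Finset.card_pos.mp (by omega)
  obtain ⟨j₀, hj₀, hmin⟩ := Finset.exists_min_image J M hJne
  set a := M j₀ with ha
  have hi₁ : i₁ ∉ J := fun h => by have := hJT h; simp [hT] at this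
  have hi₂ : i₂ ∉ J := fun h => by have := hJT h; simp [hT] at this
  have hI₁ := hI (insert i₁ J) (by rw [Finset.card_insert_of_notMem hi₁, hJc])
    (by simp [hi₂, hne.symm])
  have hI₂ := hI (insert i₂ J) (by rw [Finset.card_insert_of_notMem hi₂, hJc])
    (by simp [hi₁, hne])
  rw [Finset.sum_insert hi₁] at hI₁
  rw [Finset.sum_insert hi₂] at hI₂
  have hsplit : ∑ i, M i * (M i - a) = M i₁ * (M i₁ - a) + (M i₂ * (M i₂ - a)
      + (∑ i ∈ T \ J, M i * (M i - a) + ∑ i ∈ J, M i * (M i - a))) := by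
    rw [Finset.sum_sdiff hJT, Finset.add_sum_erase _ (fun i => M i * (M i - a)) hmem,
      Finset.add_sum_erase _ (fun i => M i * (M i - a)) (Finset.mem_univ i₁)]
  have htotal : ∑ i, M i * (M i - a)
      = ((r : ℤ) - 1) * d ^ 2 + q - (((r : ℤ) + 1) * d - p) * a := by
    simp only [mul_sub, Finset.sum_sub_distrib, hsq, ← Finset.sum_mul, hsum]
  have hout : ∑ i ∈ T \ J, M i * (M i - a) ≤ 0 :=
    Finset.sum_nonpos fun i hi =>
      mul_nonpos_of_nonneg_of_nonpos (h0 i) (by have := hJ j₀ hj₀ i hi; omega)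
  have hin : ∑ i ∈ J, M i * (M i - a) ≤ d * (∑ i ∈ J, M i - r * a) := by
    have : d * (∑ i ∈ J, M i - r * a) = ∑ i ∈ J, d * (M i - a) := by
      rw [← Finset.mul_sum, Finset.sum_sub_distrib, Finset.sum_const, hJc, nsmul_eq_mul]
    rw [this]
    exact Finset.sum_le_sum fun i hi =>
      mul_le_mul_of_nonneg_right (hle i) (by have := hmin i hi; omega)
  have hd0 : 0 ≤ d := (h0 i₁).trans (hle i₁)
  have k1 := mul_le_mul_of_nonneg_left hI₁ hd0
  have k2 := mul_le_mul_of_nonneg_left hI₂ hd0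
  have k3 := mul_nonneg (h0 j₀) hp
  rw [← ha] at k3
  rw [htotal] at hsplit
  subst hd
  rcases le_total (M i₁) (M i₂) with hle₁₂ | hle₁₂
  · have k4 := mul_nonneg (h0 i₁) (sub_nonneg.mpr hle₁₂)
    linarith
  · have k4 := mul_nonneg (h0 i₂) (sub_nonneg.mpr hle₁₂)
    linarith

variable {n r : ℕ}

/-- Suppose that `c = g ℓ` with `ℓ = h - e_1 - e_2` has a negative multiplicity at `i` and a positive
one at `j`. A suitable positive combination `F` of `g⁻¹ e_i` and `g⁻¹ e_j` is orthogonal to `ℓ`.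
If `F` has minimal degree in its orbit under the stabilizer of `ℓ`, then no `φ_I` with `I` containing
exactly one of the first two points lowers the degree of `F`, against the inequality of Noether
type. -/
theorem not_mult_neg_pos_of_le (hr : 2 ≤ r) (hrn : r + 1 ≤ n) {hs : 2 ≤ n + 1}
    {c : CurveClass (n + 1)} (hc : IsWeylLineClass r (n + 1) hs c) {i j : Fin (n + 1)}
    (hi : c.mult i < 0) (hj : 0 < c.mult j) : False := by
  obtain ⟨g, hg, hgc⟩ := isWeylLineClass_iff.mp hc
  set ℓ := lineClass (n + 1) hs with hℓ
  have hr1 : (0 : ℤ) < (r : ℤ) - 1 := by omega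
  have hij : i ≠ j := by rintro rfl; omega
  set x := c.mult j with hx
  set y := -c.mult i with hy
  have hy0 : 0 < y := by omega
  set F₀ : CurveClass (n + 1) := x • e i + y • e j with hF₀
  have hdeg : ∀ w ∈ weylGroup r (n + 1), 0 ≤ (w F₀).deg := by
    intro w hw
    rw [hF₀, map_add, map_smul, map_smul, deg_add, deg_smul, deg_smul]
    exact add_nonneg (mul_nonneg hj.le (deg_apply_e_nonneg (by omega) (by omega) hw i))
      (mul_nonneg hy0.le (deg_apply_e_nonneg (by omega) (by omega) hw j))
  -- The degrees of the translates of `F₀` by all `w` with `w c = ℓ`.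
  let S : Set ℕ := {N | ∃ w ∈ weylGroup r (n + 1), w c = ℓ ∧ (w F₀).deg.toNat = N}
  have hS : S.Nonempty := by
    refine ⟨_, g⁻¹, inv_mem hg, ?_, rfl⟩
    rw [← hgc, ← LinearEquiv.mul_apply, inv_mul_cancel]
    rfl
  obtain ⟨w, hw, hwc, hwN⟩ := Nat.sInf_mem hS
  have hmin : ∀ w' ∈ weylGroup r (n + 1), w' c = ℓ → (w F₀).deg ≤ (w' F₀).deg := by
    intro w' hw' hw'c
    have h1 : sInf S ≤ (w' F₀).deg.toNat := Nat.sInf_le ⟨w', hw', hw'c, rfl⟩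
    have := hdeg w hw
    have := hdeg w' hw'
    omega
  have hform : ∀ k, form r (w (e k)) ℓ = ((r : ℤ) - 1) * c.mult k := by
    intro k
    rw [← hwc, form_apply_apply hw, form_e_left]
  have hform' : ∀ f : CurveClass (n + 1), form r f ℓ
      = f.deg - ((r : ℤ) - 1) * (f.mult ⟨0, by omega⟩ + f.mult ⟨1, by omega⟩) :=
    fun f => form_lineClass_right hs f
  have hle : ∀ k l, ((r : ℤ) - 1) * (w (e k)).mult l ≤ (w (e k)).deg :=
    fun k l => mult_apply_e_le (by omega) (by omega) hw (by omega) l k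
  have hneg : form r (w (e i)) ℓ < 0 := by
    rw [hform]; exact mul_neg_of_pos_of_neg hr1 hi
  have hpos : 0 < form r (w (e j)) ℓ := by
    rw [hform]; exact mul_pos hr1 hj
  have hne_i : ∀ k, w (e i) ≠ e k := by
    intro k hk
    rw [hk, form_e_left, hℓ, mult_lineClass] at hneg
    have := mul_nonneg hr1.le (show (0 : ℤ) ≤ (if k = ⟨0, by omega⟩ then 1 else 0)
      + (if k = ⟨1, by omega⟩ then 1 else 0) by split_ifs <;> simp)
    omega
  have hnn_i : ∀ k, 0 ≤ (w (e i)).mult k := fun k =>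
    (eq_or_mult_apply_e_nonneg (by omega) (by omega) hw k i).resolve_left (hne_i k)
  -- `w e_j = e_k` has positive degree on `ℓ` only for the first two points `k`; as `w e_i` is
  -- orthogonal to it, `w e_i` would have multiplicity `0` there, hence non-negative degree on `ℓ`.
  have hne_j : ∀ k, w (e j) ≠ e k := by
    intro k hk
    have horth : (w (e i)).mult k = 0 := by
      have : form r (w (e i)) (w (e j)) = 0 := by
        rw [form_apply_apply hw, form_e_left, mult_e, if_neg hij, mul_zero]
      rw [hk, form_comm, form_e_left] at this
      exact (mul_eq_zero.mp this).resolve_left hr1.ne'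
    rw [hform'] at hneg
    have h0 := hle i ⟨0, by omega⟩
    have h1 := hle i ⟨1, by omega⟩
    rw [hk, form_e_left, hℓ, mult_lineClass] at hpos
    split_ifs at hpos with hk0 hk1 hk1
    · simp [hk0] at hk1
    · rw [hk0] at horth
      rw [horth] at hneg
      linarith
    · rw [hk1] at horth
      rw [horth] at hneg
      linarith
    · simp at hpos
  have hnn_j : ∀ k, 0 ≤ (w (e j)).mult k := fun k =>
    (eq_or_mult_apply_e_nonneg (by omega) (by omega) hw k j).resolve_left (hne_j k)
  have hF : w F₀ = x • w (e i) + y • w (e j) := by rw [hF₀, map_add, map_smul, map_smul]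
  set F := w F₀ with hFdef
  have hFmult : ∀ k, F.mult k = x * (w (e i)).mult k + y * (w (e j)).mult k := by
    intro k; rw [hF]; rfl
  have hFdeg' : F.deg = x * (w (e i)).deg + y * (w (e j)).deg := by rw [hF]; rfl
  have hFdeg : F.deg = ((r : ℤ) - 1) * (F.mult ⟨0, by omega⟩ + F.mult ⟨1, by omega⟩) := by
    have h1 : form r F ℓ = 0 := by
      rw [hF, form_add_left, form_smul_left, form_smul_left, hform, hform, hy]
      ring
    rw [hform'] at h1
    linarith
  have hFsq : form r F F = -((r : ℤ) - 1) * (x ^ 2 + y ^ 2) := by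
    rw [hFdef, form_apply_apply hw, hF₀]
    simp only [form_add_left, form_add_right, form_smul_left, form_smul_right, form_e_left,
      mult_e, if_neg hij, if_neg hij.symm, if_true]
    ring
  have hFK : form r F (anticanonical r (n + 1)) = ((r : ℤ) - 1) * (x + y) := by
    rw [hFdef, form_apply_anticanonical hw, hF₀, form_add_left, form_smul_left, form_smul_left,
      form_e_left, form_e_left]
    simp only [anticanonical, mult]
    ring
  rw [form_anticanonical] at hFK
  rw [form] at hFsq
  rw [hFdeg] at hFK hFsq
  refine noether_inequality (s := n + 1) (r := r) (M := F.mult) (i₁ := ⟨0, by omega⟩)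
    (i₂ := ⟨1, by omega⟩) (p := x + y) (q := x ^ 2 + y ^ 2) (by omega) (by omega) (by simp) rfl
    ?_ ?_ ?_ ?_ ?_ (by omega) (by positivity)
  · intro k
    rw [hFmult]
    exact add_nonneg (mul_nonneg hj.le (hnn_i k)) (mul_nonneg hy0.le (hnn_j k))
  · intro k
    refine le_of_mul_le_mul_left ?_ hr1
    rw [← hFdeg, hFmult, hFdeg']
    have h1 := mul_le_mul_of_nonneg_left (hle i k) hj.le
    have h2 := mul_le_mul_of_nonneg_left (hle j k) hy0.le
    linarith
  · intro I hIc hI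
    have hfix : cremonaEquiv r I hIc ℓ = ℓ := by
      have : excess I ℓ = 0 := by
        rw [hℓ, excess_lineClass]
        by_cases h0 : (⟨0, by omega⟩ : Fin (n + 1)) ∈ I
        · rw [if_pos h0, if_neg (hI.mp h0)]; rfl
        · rw [if_neg h0, if_pos (not_not.mp fun h => h0 (hI.mpr h))]; rfl
      rw [cremonaEquiv_apply, cremona_eq_add, this, zero_smul, add_zero]
    have h1 := hmin (cremonaEquiv r I hIc * w) (mul_mem (cremonaEquiv_mem I hIc) hw)
      (by rw [LinearEquiv.mul_apply, hwc, hfix])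
    rw [LinearEquiv.mul_apply, cremonaEquiv_apply, deg_cremona] at h1
    have h2 : 0 ≤ excess I F := by
      by_contra hcon
      have := mul_neg_of_pos_of_neg hr1 (not_le.mp hcon)
      linarith
    rw [excess, hFdeg] at h2
    linarith
  · refine mul_left_cancel₀ hr1.ne' ?_
    linear_combination -hFK
  · refine mul_left_cancel₀ hr1.ne' ?_
    linear_combination -hFsq

/-- Sign coherence for `s = r + 1`, where no `φ_I` contains exactly one of the first two points: by
the Cauchy-Schwarz inequality only `k = 0` and `k = -1` occur. -/
theorem not_mult_neg_pos_of_eq (hr : 2 ≤ r) {hs : 2 ≤ r + 1}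
    {c : CurveClass (r + 1)} (hc : IsWeylLineClass r (r + 1) hs c) {i j : Fin (r + 1)}
    (hi : c.mult i < 0) (hj : 0 < c.mult j) : False := by
  obtain ⟨k, -, h1, h2⟩ := hc.numerics hr
  have hcs := sq_sum_le_card_mul_sum_sq (s := Finset.univ) (f := c.mult)
  simp only [sq (c.mult _)] at hcs
  rw [h1, h2, Finset.card_univ, Fintype.card_fin] at hcs
  push_cast at hcs
  have hr' : (2 : ℤ) ≤ r := by exact_mod_cast hr
  have hk : k * (k + 1) < 1 := by
    by_contra hcon
    have := mul_le_mul_of_nonneg_left (not_lt.mp hcon) (show (0 : ℤ) ≤ r + 1 by linarith)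
    nlinarith
  have hk' : k = 0 ∨ k = -1 := by
    have h3 : -1 ≤ k := by by_contra hcon; nlinarith
    have h4 : k ≤ 0 := by by_contra hcon; nlinarith
    omega
  rcases hk' with rfl | rfl
  · rcases eq_zero_or_one_of_sum_eq (m := c.mult) (by rw [h1, h2]; ring) i with h | h <;> omega
  · rcases eq_zero_or_one_of_sum_eq (m := fun i => -c.mult i)
      (by simp only [neg_mul_neg, Finset.sum_neg_distrib, h1, h2]; ring) j with h | h <;> omega

/-- The multiplicities of a Weyl line class have the same sign. -/
theorem IsWeylLineClass.mult_nonneg_or_nonpos {s : ℕ} (hr : 2 ≤ r) (hs : r + 1 ≤ s)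
    {hs' : 2 ≤ s} {c : CurveClass s} (hc : IsWeylLineClass r s hs' c) :
    (∀ i, 0 ≤ c.mult i) ∨ ∀ i, c.mult i ≤ 0 := by
  by_contra hcon
  push Not at hcon
  obtain ⟨⟨i, hi⟩, j, hj⟩ := hcon
  obtain ⟨n, rfl⟩ : ∃ n, s = n + 1 := ⟨s - 1, by omega⟩
  rcases (show r ≤ n by omega).eq_or_lt with rfl | hlt
  · exact not_mult_neg_pos_of_eq hr hc hi hj
  · exact not_mult_neg_pos_of_le hr hlt hc hi hj

end SignCoherence

end CremonaCurve

/-! ### The reduction algorithm -/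

namespace CremonaCurve

open CurveClass

section Reduction

variable {r s : ℕ}

/-- A class in the antidominant chamber without negative multiplicities keeps the last
multiplicity non-negative along its orbit, whereas the orbit of a line contains a class
with multiplicity `-1`. -/
theorem IsWeylLineClass.not_isAntidominant (hr : 2 ≤ r) (hs : r + 1 ≤ s) {hs' : 2 ≤ s}
    {c : CurveClass s} (hc : IsWeylLineClass r s hs' c) (h0 : ∀ i, 0 ≤ c.mult i) :
    ¬ IsAntidominant r c := by
  intro hanti
  obtain ⟨n, rfl⟩ : ∃ n, s = n + 1 := ⟨s - 1, by omega⟩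
  obtain ⟨g, hg, rfl⟩ := isWeylLineClass_iff.mp hc
  set ℓ := lineClass (n + 1) hs' with hℓ
  set I := firstIndices (n + 1) (r + 1) with hI
  have hIc : I.card = r + 1 := card_firstIndices hs
  set i₂ : Fin (n + 1) := ⟨2, by omega⟩ with hi₂
  set σ := Equiv.swap (Fin.last n) i₂ with hσ
  have h1 := hanti.mult_last_le (by omega) (by omega)
    (mul_mem (mul_mem (permEquiv_mem σ) (cremonaEquiv_mem I hIc)) (inv_mem hg))
  have h2 := (h0 (Fin.last n)).trans h1
  have h3 : (permEquiv σ * cremonaEquiv r I hIc * g⁻¹) (g ℓ)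
      = permEquiv σ (cremona r I ℓ) := by
    rw [← LinearEquiv.mul_apply, inv_mul_cancel_right]
    rfl
  rw [h3, mult_permEquiv, hσ, Equiv.symm_swap, Equiv.swap_apply_left, mult_cremona,
    if_pos (mem_firstIndices.mpr (by rw [hi₂]; simp only; omega)), hℓ, excess_lineClass,
    if_pos (mem_firstIndices.mpr (by simp)), if_pos (mem_firstIndices.mpr (by simp; omega)),
    mult_lineClass] at h2
  simp [hi₂] at h2

theorem IsCremonaReduced.isAntidominant_sortMult (hs : r + 1 ≤ s) {c : CurveClass s}
    (hc : IsCremonaReduced r c) : IsAntidominant r (sortMult c) := by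
  refine ⟨?_, sortMult_antitone c⟩
  have h := hc ((firstIndices s (r + 1)).map (Tuple.sort fun i => -c.mult i).toEmbedding)
    (by rw [Finset.card_map, card_firstIndices hs])
  rw [Finset.sum_map] at h
  exact sub_nonneg.mpr h

theorem IsWeylLineClass.not_isCremonaReduced (hr : 2 ≤ r) (hs : r + 1 ≤ s) {hs' : 2 ≤ s}
    {c : CurveClass s} (hc : IsWeylLineClass r s hs' c) (h0 : ∀ i, 0 ≤ c.mult i) :
    ¬ IsCremonaReduced r c := fun hred =>
  hc.sortMult.not_isAntidominant hr hs (fun _ => h0 _) (hred.isAntidominant_sortMult hs)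

theorem IsWeylLineClass.reductionStep (hs : r + 1 ≤ s) {hs' : 2 ≤ s} {c : CurveClass s}
    (hc : IsWeylLineClass r s hs' c) : IsWeylLineClass r s hs' (reductionStep r c) :=
  hc.sortMult.apply (cremonaEquiv_mem _ (card_firstIndices hs))

/-- One round of the algorithm lowers `k = (d - 1) / (r - 1)` and keeps it positive, as long as
`k ≥ 2`. By sign coherence the new multiplicities could only become non-positive all at once; this
would force all multiplicities of `c` outside the `r + 1` largest ones to vanish. -/
theorem IsWeylLineClass.reductionStep_of_two_le (hr : 2 ≤ r) (hs : r + 1 ≤ s) {hs' : 2 ≤ s}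
    {c : CurveClass s} (hc : IsWeylLineClass r s hs' c) (hnn : c.Nonneg) {k : ℤ} (hk : 2 ≤ k)
    (hd : c.deg = 1 + ((r : ℤ) - 1) * k) :
    ∃ k' : ℤ, 1 ≤ k' ∧ k' < k ∧
      (CremonaCurve.reductionStep r c).deg = 1 + ((r : ℤ) - 1) * k' ∧
      (CremonaCurve.reductionStep r c).Nonneg := by
  have hr1 : (0 : ℤ) < (r : ℤ) - 1 := by omega
  set I := firstIndices s (r + 1) with hI
  have hIc : I.card = r + 1 := card_firstIndices hs
  set x := CremonaCurve.sortMult c with hx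
  have hxW : IsWeylLineClass r s hs' x := hc.sortMult
  have hx0 : ∀ i, 0 ≤ x.mult i := hnn.sortMult.2
  set c' := CremonaCurve.reductionStep r c with hc'
  have hc'W : IsWeylLineClass r s hs' c' := hc.reductionStep hs
  have hc'x : c' = cremona r I x := rfl
  set t := excess I x with ht
  have ht0 : t < 0 := by
    by_contra hcon
    exact hxW.not_isAntidominant hr hs hx0 ⟨not_lt.mp hcon, sortMult_antitone c⟩
  obtain ⟨k₁, hd₁, hsum₁, hsq₁⟩ := hxW.numerics hr
  have hk₁ : k₁ = k := by
    rw [hx, deg_sortMult, hd] at hd₁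
    exact (mul_left_cancel₀ hr1.ne' (add_left_cancel hd₁)).symm
  subst hk₁
  obtain ⟨k', hd', hsum', -⟩ := hc'W.numerics hr
  have hk' : k' = k₁ + t := by
    refine mul_left_cancel₀ hr1.ne' ?_
    rw [hc'x, deg_cremona, hd₁] at hd'
    linear_combination -hd'
  have hmult : ∀ i, c'.mult i = if i ∈ I then x.mult i + t else x.mult i := fun i => rfl
  have hpos : ∀ i, 0 ≤ c'.mult i := by
    rcases hc'W.mult_nonneg_or_nonpos hr hs with h | h
    · exact h
    · have hsupp : ∀ i ∉ I, x.mult i = 0 := by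
        intro i hi
        have := h i
        rw [hmult, if_neg hi] at this
        exact le_antisymm this (hx0 i)
      have := add_two_lt_card_of_mult_eq_zero hr (by omega) hsum₁ hsq₁ hsupp
      omega
  have hk0 : 0 ≤ k' := by
    have h1 : 0 ≤ ∑ i, c'.mult i := Finset.sum_nonneg fun i _ => hpos i
    rw [hsum'] at h1
    by_contra hcon
    nlinarith
  -- `φ` applied to a class with `k' = 0` and non-negative multiplicities only reaches `k ≤ 1`.
  have hkne : k' ≠ 0 := by
    intro h
    have h1 : excess I c' = -t := excess_cremona r I hIc x
    have h2 : 0 ≤ ∑ i ∈ I, c'.mult i := Finset.sum_nonneg fun i _ => hpos i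
    rw [excess, hd', h] at h1
    omega
  refine ⟨k', by omega, by omega, hd', ?_, hpos⟩
  rw [hd']
  have := mul_nonneg hr1.le hk0
  omega

theorem mult_rationalNormalClass (i : Fin s) :
    (rationalNormalClass r s).mult i = if i.val < r + 3 then 1 else 0 := by
  simp [rationalNormalClass, h, e, mult, Prod.snd_sum, Finset.sum_apply, Pi.single_apply,
    mem_firstIndices]

theorem deg_rationalNormalClass : (rationalNormalClass r s).deg = r := by
  simp [rationalNormalClass, h, e, deg, Prod.fst_sum]

/-- The classes with `k = 1` are, up to order, the class of the rational normal curve. -/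
theorem IsWeylLineClass.sortMult_eq_rationalNormalClass (hr : 2 ≤ r) {hs' : 2 ≤ s}
    {c : CurveClass s} (hc : IsWeylLineClass r s hs' c) (hd : c.deg = r) :
    CremonaCurve.sortMult c = rationalNormalClass r s := by
  have hr1 : (r : ℤ) - 1 ≠ 0 := by omega
  obtain ⟨k, hk, hsum, hsq⟩ := hc.sortMult.numerics hr
  rw [deg_sortMult, hd] at hk
  obtain rfl : k = 1 := mul_left_cancel₀ hr1 (by linear_combination -hk)
  refine CurveClass.ext' (by rw [deg_sortMult, hd, deg_rationalNormalClass]) fun i => ?_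
  rw [mult_rationalNormalClass]
  refine eq_ite_of_antitone (sortMult_antitone c)
    (eq_zero_or_one_of_sum_eq (by rw [hsum, hsq]; ring)) (by rw [hsum]; push_cast; ring) i

theorem IsWeylLineClass.exists_iterate (hr : 2 ≤ r) (hs : r + 1 ≤ s) {hs' : 2 ≤ s}
    {c : CurveClass s} (hc : IsWeylLineClass r s hs' c) (hnn : c.Nonneg) {k : ℤ} (hk : 1 ≤ k)
    (hd : c.deg = 1 + ((r : ℤ) - 1) * k) :
    ∃ n : ℕ,
      (∀ k < n, ((CremonaCurve.reductionStep r)^[k + 1] c).deg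
        < ((CremonaCurve.reductionStep r)^[k] c).deg) ∧
      (∀ k ≤ n, ((CremonaCurve.reductionStep r)^[k] c).Nonneg) ∧
      CremonaCurve.sortMult ((CremonaCurve.reductionStep r)^[n] c) = rationalNormalClass r s := by
  generalize hN : k.toNat = N
  induction N using Nat.strong_induction_on generalizing c k with
  | _ N ih =>
  rcases hk.eq_or_lt with rfl | hk
  · exact ⟨0, by simp, by simpa using hnn,
      hc.sortMult_eq_rationalNormalClass hr (by rw [hd]; ring)⟩
  · obtain ⟨k', hk1, hlt, hd', hnn'⟩ := hc.reductionStep_of_two_le hr hs hnn hk hd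
    obtain ⟨n, h1, h2, h3⟩ := ih k'.toNat (by omega) (hc.reductionStep hs) hnn' hk1 hd' rfl
    refine ⟨n + 1, fun m hm => ?_, fun m hm => ?_, h3⟩
    · cases m with
      | zero =>
        change (CremonaCurve.reductionStep r c).deg < c.deg
        rw [hd, hd']
        have : (0 : ℤ) < (r : ℤ) - 1 := by omega
        have := mul_lt_mul_of_pos_left hlt this
        omega
      | succ m => exact h1 m (by omega)
    · cases m with
      | zero => exact hnn
      | succ m => exact h2 m (by omega)

theorem sortMult_phi_rationalNormalClass (hs : r + 3 ≤ s) :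
    sortMult (phi r (rationalNormalClass r s)) = lineClass s (by omega) := by
  have hex : excess (firstIndices s (r + 1)) (rationalNormalClass r s) = -1 := by
    have : ∑ i ∈ firstIndices s (r + 1), (rationalNormalClass r s).mult i
        = ∑ i ∈ firstIndices s (r + 1), 1 :=
      Finset.sum_congr rfl fun i hi => by
        have := mem_firstIndices.mp hi
        rw [mult_rationalNormalClass, if_pos (by omega)]
    rw [excess, this, deg_rationalNormalClass, Finset.sum_const, card_firstIndices (by omega)]
    push_cast [nsmul_eq_mul]
    ring
  have hmult : ∀ i, (phi r (rationalNormalClass r s)).mult i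
      = (if i ∈ firstIndices s (r + 3) then 1 else 0)
        - (if i ∈ firstIndices s (r + 1) then 1 else 0) := by
    intro i
    rw [phi, mult_cremona, hex, mult_rationalNormalClass]
    simp only [mem_firstIndices]
    split_ifs <;> omega
  have hsum : ∑ i, (sortMult (phi r (rationalNormalClass r s))).mult i = (2 : ℕ) := by
    rw [sum_mult_sortMult]
    simp only [hmult, Finset.sum_sub_distrib, Finset.sum_ite_mem, Finset.univ_inter,
      Finset.sum_const, card_firstIndices hs, card_firstIndices (show r + 1 ≤ s by omega)]
    push_cast [nsmul_eq_mul]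
    ring
  refine CurveClass.ext' ?_ fun i => ?_
  · rw [deg_sortMult, deg_lineClass, phi, deg_cremona, hex, deg_rationalNormalClass]
    ring
  · rw [eq_ite_of_antitone (sortMult_antitone _) (fun i => ?_) hsum, mult_lineClass]
    · simp only [Fin.ext_iff]
      split_ifs <;> omega
    · rw [mult_sortMult, hmult]
      simp only [mem_firstIndices]
      split_ifs <;> omega

end Reduction

end CremonaCurve

theorem mainTheorem7 (r s : ℕ) (hr : 2 ≤ r) (hs : r + 1 ≤ s)
    (c : CremonaCurve.CurveClass s)
    (hc : CremonaCurve.IsWeylLineClass r s (by omega) c)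
    (hnonneg : c.Nonneg) :
    ¬ CremonaCurve.IsCremonaReduced r c ∧
    ((r : ℤ) < c.deg → r + 3 ≤ s ∧
      ∃ n : ℕ,
        (∀ k < n, ((CremonaCurve.reductionStep r)^[k + 1] c).deg
          < ((CremonaCurve.reductionStep r)^[k] c).deg) ∧
        (∀ k ≤ n, ((CremonaCurve.reductionStep r)^[k] c).Nonneg) ∧
        CremonaCurve.sortMult ((CremonaCurve.reductionStep r)^[n] c)
          = CremonaCurve.rationalNormalClass r s) ∧
    (r + 3 ≤ s →
      CremonaCurve.sortMult (CremonaCurve.phi r (CremonaCurve.rationalNormalClass r s))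
        = CremonaCurve.lineClass s (by omega)) := by
  refine ⟨hc.not_isCremonaReduced hr hs hnonneg.2, fun hdeg => ?_,
    fun h => CremonaCurve.sortMult_phi_rationalNormalClass h⟩
  obtain ⟨k, hk, hsum, hsq⟩ := hc.numerics hr
  have hk1 : 1 ≤ k := by
    by_contra hcon
    have : (0 : ℤ) ≤ (r : ℤ) - 1 := by omega
    have := mul_nonneg this (show 0 ≤ -k by omega)
    have hr' : (2 : ℤ) ≤ r := by exact_mod_cast hr
    nlinarith
  refine ⟨?_, hc.exists_iterate hr hs hnonneg hk1 hk⟩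
  have := CremonaCurve.add_two_lt_card_of_mult_eq_zero hr hk1 hsum hsq
    (J := Finset.univ) (fun i hi => absurd (Finset.mem_univ i) hi)
  rw [Finset.card_univ, Fintype.card_fin] at this
  omega
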